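/- **Theorem 1.** A stream is a finite or infinite sequence $e_1,e_2,\dots$ of weighted edges (no loops; parallel and repeated edges are allowed) on a vertex set $V$ with $n=|V|\ge 3$. For a window length $L\ge 1$, the current window after $e_i$ is $E_i=\{e_j : \max\{i-L+1,1\}\le j\le i\}$. The weights are taken from a finite set $W$ of positive reals that is known to the algorithm and satisfies $|W|\le n^{K}$, i.e. a weight can be stored in $O(\log n)$ bits. For a non-empty finite stream $S$, let $w_{\max}$ and $w_{\min}$ be the largest and the smallest weight of an edge in $S$ (not known to the algorithm in advance), and let $\sigma=\sigma(S)=\frac n2\cdot w_{\max}/w_{\min}$. A deterministic streaming algorithm reads the edges one by one and updates a memory, which is a string of bits, as a function of the old memory and the new edge; its report is a function of the memory. The space it uses on $S$ is the largest length in bits of the memory, initially or after any of the edges of $S$. For every constant $K$ there is a constant $C>0$, depending only on $K$, such that for all $n\ge 3$, $L\ge 1$, $0<\varepsilon\le 0.1$ and all $W$ as above there is a deterministic streaming algorithm that, after every edge of every stream with weights in $W$, reports a matching $M$ consisting of edges of the current window, with $w(M')\le (3+\varepsilon)\,w(M)$ for every matching $M'$ in the graph spanned by the current window, and that uses on every non-empty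 finite stream at most $$C\cdot\Bigl(\frac{\log(1/\varepsilon)}{\varepsilon^2}\cdot n\cdot\log^2\sigma+\frac1\varepsilon\cdot\log\sigma\cdot\log L\Bigr)$$ bits of space (the second term pays for the counters of positions in the window). In particular, if $L\le n^{Kn}$, the space is at most $C\cdot\frac{\log(1/\varepsilon)}{\varepsilon^2}\cdot n\cdot\log^2\sigma$ bits; and if moreover $w_{\max}/w_{\min}\le n^{K}$, it is at most $C\cdot\frac{\log(1/\varepsilon)}{\varepsilon^2}\cdot n\cdot\log^2 n$ bits, which is $\tilde O(n)$ for fixed $\varepsilon$. -/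

import Mathlib

/-- An item of the stream: an edge on the vertex set `Fin n` (no loops), with a weight from the
set `W` of admissible weights. Parallel edges are allowed to arrive. -/
structure WEdge (n : ℕ) (W : Finset ℝ) where
  ends : Sym2 (Fin n)
  notLoop : ¬ ends.IsDiag
  weight : ℝ
  weight_mem : weight ∈ W

/-- A deterministic one-pass streaming algorithm with inputs in `I` and reports in `O`.
Everything it remembers between two items is a string of bits. -/
structure StreamingAlgorithm (I O : Type) where
  init : List Bool
  step : List Bool → I → List Bool
  report : List Bool → O

namespace StreamingAlgorithm

variable {I O : Type}

/-- The memory contents after the items of `s` have been processed in order. -/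
def memory (A : StreamingAlgorithm I O) (s : List I) : List Bool :=
  s.foldl A.step A.init

/-- The report after the items of `s` have been processed. -/
def reportAfter (A : StreamingAlgorithm I O) (s : List I) : O :=
  A.report (A.memory s)

/-- The space used on `s`: the largest number of bits in memory at any moment of the run on `s`
(initially, or after one of the items). -/
def space (A : StreamingAlgorithm I O) (s : List I) : ℕ :=
  (Finset.range (s.length + 1)).sup fun i => (A.memory (s.take i)).length

end StreamingAlgorithm

/-- The sliding window: the `L` most recent items of `s` (all of `s` if it has at most `L`). -/
def slidingWindow {I : Type} (L : ℕ) (s : List I) : List I :=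
  s.drop (s.length - L)

section Matching

variable {n : ℕ} {W : Finset ℝ}

/-- `M` is a matching in the graph spanned by the edges in `E`. -/
def IsMatchingIn (E : List (WEdge n W)) (M : Finset (WEdge n W)) : Prop :=
  (∀ e ∈ M, e ∈ E) ∧
    ∀ e ∈ M, ∀ f ∈ M, e ≠ f → ∀ v : Fin n, ¬ (v ∈ e.ends ∧ v ∈ f.ends)

/-- The total weight of a set of edges. -/
noncomputable def totalWeight (M : Finset (WEdge n W)) : ℝ :=
  ∑ e ∈ M, e.weight

/-- `M` is an `α`-approximate maximum-weight matching in the graph spanned by `E`. -/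
def IsApproxMWM (α : ℝ) (E : List (WEdge n W)) (M : Finset (WEdge n W)) : Prop :=
  IsMatchingIn E M ∧ ∀ M', IsMatchingIn E M' → totalWeight M' ≤ α * totalWeight M

/-- The largest weight of an edge in the stream `s` (meant for `s ≠ []`). -/
noncomputable def wMax (s : List (WEdge n W)) : ℝ :=
  sSup (WEdge.weight '' {e | e ∈ s})

/-- The smallest weight of an edge in the stream `s` (meant for `s ≠ []`). -/
noncomputable def wMin (s : List (WEdge n W)) : ℝ :=
  sInf (WEdge.weight '' {e | e ∈ s})

/-- `σ = (n / 2) * (w_max / w_min)` for the stream `s` (meant for `s ≠ []`). -/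
noncomputable def sigma (s : List (WEdge n W)) : ℝ :=
  (n : ℝ) / 2 * (wMax s / wMin s)

end Matching

/-!
The algorithm combines the local-ratio method with a smooth histogram.

*Local ratio.* A run over a list of edges keeps a potential for every vertex. An edge whose weight
exceeds `1 + η` times the potentials of its two ends is pushed on a stack; the excess over the
potentials is its gain, which is added to both potentials. Unwinding the stack greedily gives a
matching at least as heavy as the total gain (`le_sum_greedy`), while the potentials cover all
weights up to the factor `1 + η`, so the optimum is at most `2 * (1 + η)` times the gain
(`sum_weight_le`).

*Smooth histogram.* Runs are started at several positions ("buckets"). If the run on `Y` has nearly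
the gain of the run on `X ++ Y`, then the former may replace the latter for good: for every
continuation `Z`, the gain on `Y ++ Z` is within a factor of about `3` of the optimum on
`X ++ Y ++ Z` (`sum_weight_le_of_smooth`). The reason is that the edges of an optimal matching are
covered by the potentials of `Y ++ Z` except for residual weights on `X`; these residual weights can
be put on top of the stack of `Y`, so together with the gain on `Y` they are at most the optimum on
`X ++ Y`, hence at most about twice the gain on `Y`. Consequently a bucket can be deleted as soon as
its two neighbours have nearly the same gain, and since gains then drop by the factor `1 - η` every
two buckets, `O (log σ / η)` buckets are left (`Invariant.length_le`).

*Space.* A run needs little memory. Edges of the stack that are light against the current potential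
of one of their ends carry a fraction of at most `2 * η` of the gain
(`IsStack.le_totalGain_filter`) and are forgotten; since each push multiplies the potentials of both
ends by `1 + η`, only `O (log (1 / η) / η)` heavy edges are left at each vertex
(`IsSteep.pow_countP_keep_le`). The weights are rounded down to multiples of powers of two, so that
all potentials are integer multiples of a unit that is determined by the smallest weight
(`roundDown_mem_zmultiples`) and take `O (log σ + log (1 / η))` bits each. A state is stored as a
shortest code word among its descriptions (`exists_streamingAlgorithm`), so the smallest weight need
not be known in advance. The theorem follows with `η = ε / 20`.
-/

namespace LocalRatio

/-! ### Local-ratio stacks and greedy unwinding -/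

section Stack

variable {V E : Type} [DecidableEq V] (ends : E → Finset V) (w : E → ℝ)

/-- The potential of the vertex `v` under a stack of pairs (edge, gain): the sum of the gains of
the edges of the stack that are incident to `v`. -/
def potential (l : List (E × ℝ)) (v : V) : ℝ :=
  (l.map fun p => if v ∈ ends p.1 then p.2 else 0).sum

/-- The sum of all gains on a stack. -/
def totalGain (l : List (E × ℝ)) : ℝ := (l.map Prod.snd).sum

/-- A local-ratio stack, newest item first: every gain is non-negative and, together with the
potentials that the older items give to the ends of the edge, is at most the weight of the edge. -/
def IsStack : List (E × ℝ) → Prop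
  | [] => True
  | p :: l => 0 ≤ p.2 ∧ p.2 + ∑ v ∈ ends p.1, potential ends l v ≤ w p.1 ∧ IsStack l

@[simp] lemma potential_nil (v : V) : potential ends [] v = 0 := by simp [potential]

@[simp] lemma potential_cons (p : E × ℝ) (l : List (E × ℝ)) (v : V) :
    potential ends (p :: l) v = (if v ∈ ends p.1 then p.2 else 0) + potential ends l v := by
  simp [potential]

@[simp] lemma totalGain_nil : totalGain ([] : List (E × ℝ)) = 0 := by simp [totalGain]

@[simp] lemma totalGain_cons (p : E × ℝ) (l : List (E × ℝ)) :
    totalGain (p :: l) = p.2 + totalGain l := by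
  simp [totalGain]

variable {ends w}

lemma IsStack.potential_nonneg {l : List (E × ℝ)} (h : IsStack ends w l) (v : V) :
    0 ≤ potential ends l v := by
  induction l with
  | nil => simp
  | cons p l ih =>
    rw [potential_cons]
    have := ih h.2.2
    have := h.1
    split_ifs <;> linarith

lemma IsStack.totalGain_nonneg {l : List (E × ℝ)} (h : IsStack ends w l) : 0 ≤ totalGain l := by
  induction l with
  | nil => simp
  | cons p l ih =>
    rw [totalGain_cons]
    linarith [ih h.2.2, h.1]

/-- Forgetting items of a stack only lowers potentials, so what remains is a stack. -/
lemma IsStack.sublist {l' l : List (E × ℝ)} (hl : l'.Sublist l) (h : IsStack ends w l) :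
    IsStack ends w l' ∧ ∀ v, potential ends l' v ≤ potential ends l v := by
  induction hl with
  | slnil => exact ⟨trivial, fun _ => le_rfl⟩
  | @cons l₁ l₂ p _ ih =>
    obtain ⟨h1, h2⟩ := ih h.2.2
    refine ⟨h1, fun v => (h2 v).trans ?_⟩
    rw [potential_cons]
    have := h.1
    split_ifs <;> linarith
  | @cons_cons l₁ l₂ p _ ih =>
    obtain ⟨h1, h2⟩ := ih h.2.2
    refine ⟨⟨h.1, ?_, h1⟩, fun v => ?_⟩
    · have := Finset.sum_le_sum fun v (_ : v ∈ ends p.1) => h2 v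
      linarith [h.2.1]
    · rw [potential_cons, potential_cons]
      linarith [h2 v]

/-- Every edge has two ends, so it contributes its gain to two potentials. -/
lemma sum_potential [Fintype V] (hc : ∀ e, (ends e).card = 2) (l : List (E × ℝ)) :
    ∑ v, potential ends l v = 2 * totalGain l := by
  induction l with
  | nil => simp
  | cons p l ih =>
    simp only [potential_cons, Finset.sum_add_distrib, ih, totalGain_cons, Finset.sum_ite_mem,
      Finset.univ_inter, Finset.sum_const, hc, nsmul_eq_mul]
    push_cast
    ring

variable (ends)

open Classical in
/-- Unwinding a stack: go through the edges, newest first, and take every edge that avoids the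
vertices in `U` and the edges taken before. -/
noncomputable def greedy : List E → Finset V → Finset E
  | [], _ => ∅
  | e :: l, U => if Disjoint (ends e) U then insert e (greedy l (U ∪ ends e)) else greedy l U

variable {ends}

open Classical in
lemma mem_of_mem_greedy {l : List E} {U : Finset V} {e : E} (he : e ∈ greedy ends l U) :
    e ∈ l ∧ Disjoint (ends e) U := by
  induction l generalizing U with
  | nil => simp [greedy] at he
  | cons a l ih =>
    rw [greedy] at he
    split_ifs at he with ha
    · rcases Finset.mem_insert.1 he with rfl | he
      · exact ⟨List.mem_cons_self, ha⟩
      · obtain ⟨h1, h2⟩ := ih he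
        exact ⟨List.mem_cons_of_mem _ h1, (Finset.disjoint_union_right.1 h2).1⟩
    · obtain ⟨h1, h2⟩ := ih he
      exact ⟨List.mem_cons_of_mem _ h1, h2⟩

open Classical in
lemma greedy_pairwiseDisjoint (l : List E) (U : Finset V) :
    (greedy ends l U : Set E).PairwiseDisjoint ends := by
  induction l generalizing U with
  | nil => simp [greedy]
  | cons a l ih =>
    rw [greedy]
    split_ifs with ha
    · rw [Finset.coe_insert]
      refine (ih _).insert fun e he _ => ?_
      exact (Finset.disjoint_union_right.1 (mem_of_mem_greedy he).2).2.symm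
    · exact ih _

open Classical in
/-- The weight of the unwound matching pays for all gains, except those that the forbidden
vertices `U` may have blocked: a chosen edge pays for its own gain and for all older gains
at its ends. -/
lemma le_sum_greedy (hne : ∀ e, (ends e).Nonempty) {l : List (E × ℝ)} (h : IsStack ends w l)
    (U : Finset V) :
    totalGain l - ∑ v ∈ U, potential ends l v ≤ ∑ e ∈ greedy ends (l.map Prod.fst) U, w e := by
  induction l generalizing U with
  | nil => simp [greedy]
  | cons p l ih =>
    rw [List.map_cons, greedy]
    obtain ⟨h0, h1, h2⟩ := h
    split_ifs with hp
    · rw [Finset.sum_insert]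
      · have ih' := ih h2 (U ∪ ends p.1)
        rw [Finset.sum_union hp.symm] at ih'
        have hU : ∑ v ∈ U, potential ends (p :: l) v = ∑ v ∈ U, potential ends l v := by
          refine Finset.sum_congr rfl fun v hv => ?_
          rw [potential_cons, if_neg (Finset.disjoint_right.1 hp hv), zero_add]
        rw [totalGain_cons, hU]
        linarith
      · intro hmem
        have := (Finset.disjoint_union_right.1 (mem_of_mem_greedy hmem).2).2
        exact (hne p.1).ne_empty (disjoint_self.1 this)
    · refine le_trans ?_ (ih h2 U)
      obtain ⟨v, hv1, hv2⟩ := Finset.not_disjoint_iff.1 hp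
      have : ∑ u ∈ U, potential ends l u + p.2 ≤ ∑ u ∈ U, potential ends (p :: l) u := by
        simp only [potential_cons, Finset.sum_add_distrib]
        have := Finset.single_le_sum (f := fun u => if u ∈ ends p.1 then p.2 else 0)
          (fun u _ => by split_ifs <;> linarith) hv2
        simp only [hv1, if_true] at this
        linarith
      rw [totalGain_cons]
      linarith

lemma sum_sum_ends_le [Fintype V] {M : Finset E} (hM : (M : Set E).PairwiseDisjoint ends)
    {φ : V → ℝ} (hφ : ∀ v, 0 ≤ φ v) : ∑ e ∈ M, ∑ v ∈ ends e, φ v ≤ ∑ v, φ v := by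
  rw [← Finset.sum_biUnion hM]
  exact Finset.sum_le_sum_of_subset_of_nonneg (Finset.subset_univ _) fun v _ _ => hφ v

/-- The edges of a matching, with their non-negative residual weights as gains, can be put on top
of any stack. -/
lemma exists_isStack_of_residual {l : List (E × ℝ)} (hl : IsStack ends w l) (M : List E)
    (hM : M.Pairwise fun e f => Disjoint (ends e) (ends f))
    (hr : ∀ e ∈ M, ∑ v ∈ ends e, potential ends l v ≤ w e) :
    IsStack ends w ((M.map fun e => (e, w e - ∑ v ∈ ends e, potential ends l v)) ++ l) ∧
      ∀ v, (∀ e ∈ M, v ∉ ends e) →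
        potential ends ((M.map fun e => (e, w e - ∑ v ∈ ends e, potential ends l v)) ++ l) v
          = potential ends l v := by
  induction M with
  | nil => exact ⟨hl, fun _ _ => rfl⟩
  | cons a M ih =>
    rw [List.pairwise_cons] at hM
    obtain ⟨ih1, ih2⟩ := ih hM.2 fun e he => hr e (List.mem_cons_of_mem _ he)
    refine ⟨⟨?_, ?_, ih1⟩, fun v hv => ?_⟩
    · have := hr a List.mem_cons_self
      simp only
      linarith
    · have := Finset.sum_congr rfl fun v hv => ih2 v fun e he hve =>
        Finset.disjoint_left.1 (hM.1 e he) hv hve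
      change w a - _ + ∑ v ∈ ends a, potential ends (_ ++ l) v ≤ w a
      rw [this]
      linarith
    · rw [List.map_cons, List.cons_append, potential_cons, if_neg (hv a List.mem_cons_self),
        zero_add]
      exact ih2 v fun e he => hv e (List.mem_cons_of_mem _ he)

end Stack

/-! ### The one-pass local-ratio run -/

section Run

variable {V E : Type} [DecidableEq V] (ends : E → Finset V) (w : E → ℝ) (η : ℝ)

open Classical in
/-- One step of the local-ratio algorithm: an edge whose weight exceeds the potentials of its ends
by the factor `1 + η` is pushed on the stack, and its gain is the excess. -/
noncomputable def push (l : List (E × ℝ)) (e : E) : List (E × ℝ) :=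
  if (1 + η) * ∑ v ∈ ends e, potential ends l v < w e then
    (e, w e - ∑ v ∈ ends e, potential ends l v) :: l
  else l

/-- The full stack after the edges of `X` have been processed in order. -/
noncomputable def run (X : List E) : List (E × ℝ) := X.foldl (push ends w η) []

/-- A stack all of whose items were pushed under the condition of `push`, expressed as lower
bounds on the gains. -/
def IsSteep : List (E × ℝ) → Prop
  | [] => True
  | p :: l => η * ∑ v ∈ ends p.1, potential ends l v ≤ p.2 ∧ η * w p.1 ≤ (1 + η) * p.2 ∧ IsSteep l

variable {ends w η}

lemma run_append_singleton (X : List E) (e : E) :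
    run ends w η (X ++ [e]) = push ends w η (run ends w η X) e := by
  simp [run]

lemma suffix_push (l : List (E × ℝ)) (e : E) : l <:+ push ends w η l e := by
  unfold push
  split_ifs
  · exact List.suffix_cons _ _
  · exact List.suffix_rfl

lemma run_suffix_append (X Y : List E) : run ends w η X <:+ run ends w η (X ++ Y) := by
  induction Y using List.reverseRecOn with
  | nil => simp
  | append_singleton Y e ih =>
    rw [← List.append_assoc, run_append_singleton]
    exact ih.trans (suffix_push _ _)

lemma mem_of_mem_run {X : List E} {p : E × ℝ} (hp : p ∈ run ends w η X) : p.1 ∈ X := by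
  induction X using List.reverseRecOn with
  | nil => simp [run] at hp
  | append_singleton X e ih =>
    rw [run_append_singleton] at hp
    unfold push at hp
    split_ifs at hp
    · rcases List.mem_cons.1 hp with rfl | hp
      · simp
      · exact List.mem_append_left _ (ih hp)
    · exact List.mem_append_left _ (ih hp)

lemma isStack_push (hη : 0 ≤ η) {l : List (E × ℝ)} (h : IsStack ends w l) (e : E) :
    IsStack ends w (push ends w η l e) := by
  unfold push
  split_ifs with hc
  · refine ⟨?_, by simp, h⟩
    have := mul_nonneg hη (Finset.sum_nonneg fun v (_ : v ∈ ends e) => h.potential_nonneg v)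
    simp only
    linarith
  · exact h

lemma isStack_run (hη : 0 ≤ η) (X : List E) : IsStack ends w (run ends w η X) := by
  induction X using List.reverseRecOn with
  | nil => trivial
  | append_singleton X e ih =>
    rw [run_append_singleton]
    exact isStack_push hη ih e

lemma isSteep_run (X : List E) : IsSteep ends w η (run ends w η X) := by
  induction X using List.reverseRecOn with
  | nil => trivial
  | append_singleton X e ih =>
    rw [run_append_singleton, push]
    split_ifs with hc
    · refine ⟨?_, ?_, ih⟩ <;> simp only <;> linarith
    · exact ih

lemma potential_run_mono (hη : 0 ≤ η) (X Y : List E) (v : V) :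
    potential ends (run ends w η X) v ≤ potential ends (run ends w η (X ++ Y)) v :=
  ((isStack_run hη _).sublist (run_suffix_append X Y).sublist).2 v

lemma IsStack.totalGain_le_of_suffix {l l' : List (E × ℝ)} (h : IsStack ends w l)
    (hl : l' <:+ l) : totalGain l' ≤ totalGain l := by
  obtain ⟨t, rfl⟩ := hl
  induction t with
  | nil => simp
  | cons p t ih =>
    rw [List.cons_append, totalGain_cons]
    have h' : IsStack ends w (p :: (t ++ l')) := h
    linarith [ih h'.2.2, h'.1]

lemma totalGain_run_mono (hη : 0 ≤ η) (X Y : List E) :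
    totalGain (run ends w η X) ≤ totalGain (run ends w η (X ++ Y)) :=
  (isStack_run hη _).totalGain_le_of_suffix (run_suffix_append X Y)

/-- After the run, `1 + η` times the potentials form a fractional vertex cover of the weights. -/
lemma weight_le_of_mem (hη : 0 ≤ η) (hne : ∀ e, (ends e).Nonempty) {X : List E} {e : E}
    (he : e ∈ X) : w e ≤ (1 + η) * ∑ v ∈ ends e, potential ends (run ends w η X) v := by
  induction X using List.reverseRecOn with
  | nil => simp at he
  | append_singleton X a ih =>
    by_cases hX : e ∈ X
    · refine (ih hX).trans (mul_le_mul_of_nonneg_left ?_ (by linarith))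
      exact Finset.sum_le_sum fun v _ => potential_run_mono hη X [a] v
    · have hea : e = a := by simpa [hX] using he
      subst hea
      rw [run_append_singleton]
      have hS := isStack_push hη (isStack_run (ends := ends) (w := w) hη X) e
      have h0 := Finset.sum_nonneg fun v (_ : v ∈ ends e) => hS.potential_nonneg v
      have h1 := mul_nonneg hη h0
      by_cases hc : (1 + η) * ∑ v ∈ ends e, potential ends (run ends w η X) v < w e
      · have hg : 0 ≤ w e - ∑ v ∈ ends e, potential ends (run ends w η X) v := by
          rw [push, if_pos hc] at hS
          exact hS.1
        have h2 : w e ≤ ∑ v ∈ ends e, potential ends (push ends w η (run ends w η X) e) v := by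
          rw [push, if_pos hc]
          simp only [potential_cons, Finset.sum_add_distrib]
          obtain ⟨u, hu⟩ := hne e
          have := Finset.single_le_sum (s := ends e) (f := fun v => if v ∈ ends e then
            w e - ∑ v ∈ ends e, potential ends (run ends w η X) v else 0)
            (fun u _ => by split_ifs; linarith) hu
          simp only [hu, if_true] at this
          linarith
        linarith
      · rw [push, if_neg hc]
        linarith

/-- A potential never exceeds the largest weight: the last push at a vertex is bounded by the
weight of the pushed edge. -/
lemma IsStack.potential_le {l : List (E × ℝ)} (h : IsStack ends w l) {v : V} {B : ℝ} (hB : 0 ≤ B)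
    (hw : ∀ p ∈ l, w p.1 ≤ B) : potential ends l v ≤ B := by
  induction l with
  | nil => simpa
  | cons p l ih =>
    rw [potential_cons]
    split_ifs with hv
    · have := Finset.single_le_sum (f := fun u => potential ends l u)
        (fun u _ => h.2.2.potential_nonneg u) hv
      have h1 := h.2.1
      have h2 := hw p List.mem_cons_self
      linarith
    · rw [zero_add]
      exact ih h.2.2 fun q hq => hw q (List.mem_cons_of_mem _ hq)

end Run

/-! ### The approximation guarantee -/

section Approximation

variable {V E : Type} [Fintype V] [DecidableEq V] {ends : E → Finset V} {w : E → ℝ} {η : ℝ}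

lemma sum_weight_le (hη : 0 ≤ η) (hc : ∀ e, (ends e).card = 2) {X : List E} {M : Finset E}
    (hM : (M : Set E).PairwiseDisjoint ends) (hX : ∀ e ∈ M, e ∈ X) :
    ∑ e ∈ M, w e ≤ 2 * (1 + η) * totalGain (run ends w η X) := by
  have hne : ∀ e, (ends e).Nonempty := fun e => Finset.card_pos.1 (by rw [hc]; norm_num)
  calc ∑ e ∈ M, w e
      ≤ ∑ e ∈ M, (1 + η) * ∑ v ∈ ends e, potential ends (run ends w η X) v :=
        Finset.sum_le_sum fun e he => weight_le_of_mem hη hne (hX e he)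
    _ = (1 + η) * ∑ e ∈ M, ∑ v ∈ ends e, potential ends (run ends w η X) v := by
        rw [Finset.mul_sum]
    _ ≤ (1 + η) * ∑ v, potential ends (run ends w η X) v :=
        mul_le_mul_of_nonneg_left
          (sum_sum_ends_le hM fun v => (isStack_run hη X).potential_nonneg v) (by linarith)
    _ = _ := by rw [sum_potential hc]; ring

/-- The residual weights of a matching with respect to the potentials of `Y`, together with the
gain on `Y`, are the value of a matching in `X ++ Y`. -/
lemma sum_residual_add_totalGain_le (hη : 0 ≤ η) (hc : ∀ e, (ends e).card = 2) {X Y : List E}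
    {M : Finset E} (hM : (M : Set E).PairwiseDisjoint ends) (hX : ∀ e ∈ M, e ∈ X)
    (hr : ∀ e ∈ M, ∑ v ∈ ends e, potential ends (run ends w η Y) v ≤ w e) :
    ∑ e ∈ M, (w e - ∑ v ∈ ends e, potential ends (run ends w η Y) v)
      + totalGain (run ends w η Y) ≤ 2 * (1 + η) * totalGain (run ends w η (X ++ Y)) := by
  have hne : ∀ e, (ends e).Nonempty := fun e => Finset.card_pos.1 (by rw [hc]; norm_num)
  set l := run ends w η Y
  have hpw : M.toList.Pairwise fun e f => Disjoint (ends e) (ends f) := by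
    refine (M.nodup_toList).pairwise_of_forall_ne fun e he f hf hef => ?_
    exact hM (by simpa using he) (by simpa using hf) hef
  obtain ⟨hS, -⟩ := exists_isStack_of_residual (isStack_run (ends := ends) (w := w) hη Y)
    M.toList hpw fun e he => hr e (by simpa using he)
  have hg := le_sum_greedy hne hS ∅
  have hsum : totalGain ((M.toList.map fun e => (e, w e - ∑ v ∈ ends e, potential ends l v)) ++ l)
      = ∑ e ∈ M, (w e - ∑ v ∈ ends e, potential ends l v) + totalGain l := by
    simp [totalGain, Function.comp_def]
  rw [Finset.sum_empty, sub_zero, hsum] at hg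
  refine hg.trans (sum_weight_le hη hc (greedy_pairwiseDisjoint _ _) fun e he => ?_)
  have := (mem_of_mem_greedy he).1
  rw [List.map_append, List.mem_append, List.map_map] at this
  rcases this with h | h
  · refine List.mem_append_left _ (hX e ?_)
    simpa [Function.comp_def] using h
  · obtain ⟨p, hp, rfl⟩ := List.mem_map.1 h
    exact List.mem_append_right _ (mem_of_mem_run hp)

/-- Suppose that at some moment the run started after `X` had nearly the gain of the run started
before `X`. Then at every later moment it is within a factor of about `3` of the optimum over
all edges, those of `X` included. -/
lemma sum_weight_le_of_smooth (hη : 0 ≤ η) (hη1 : η ≤ 1) (hc : ∀ e, (ends e).card = 2)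
    {X Y Z : List E}
    (hXY : (1 - η) * totalGain (run ends w η (X ++ Y)) ≤ totalGain (run ends w η Y))
    {M : Finset E} (hM : (M : Set E).PairwiseDisjoint ends) (hMX : ∀ e ∈ M, e ∈ X ++ Y ++ Z) :
    (1 - η) * ∑ e ∈ M, w e ≤ 3 * (1 + η) * totalGain (run ends w η (Y ++ Z)) := by
  classical
  have hne : ∀ e, (ends e).Nonempty := fun e => Finset.card_pos.1 (by rw [hc]; norm_num)
  set p := potential ends (run ends w η Y)
  set q := potential ends (run ends w η (Y ++ Z))
  have hpq : ∀ v, p v ≤ q v := potential_run_mono hη Y Z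
  have hq0 : ∀ v, 0 ≤ q v := (isStack_run hη _).potential_nonneg
  set M₁ := M.filter fun e => e ∉ Y ++ Z ∧ ∑ v ∈ ends e, p v ≤ w e
  have hM₁ : M₁ ⊆ M := Finset.filter_subset _ _
  -- Only the edges of `M₁` can exceed what the potentials of `Y ++ Z` cover.
  have hpt : ∀ e ∈ M, w e ≤ (1 + η) * ∑ v ∈ ends e, q v +
      if e ∈ M₁ then w e - ∑ v ∈ ends e, p v else 0 := by
    intro e he
    have h0 : 0 ≤ η * ∑ v ∈ ends e, q v :=
      mul_nonneg hη (Finset.sum_nonneg fun v _ => hq0 v)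
    have h1 : ∑ v ∈ ends e, p v ≤ ∑ v ∈ ends e, q v := Finset.sum_le_sum fun v _ => hpq v
    by_cases hYZ : e ∈ Y ++ Z
    · have : e ∉ M₁ := fun h => (Finset.mem_filter.1 h).2.1 hYZ
      rw [if_neg this, add_zero]
      exact weight_le_of_mem hη hne hYZ
    · by_cases hw : ∑ v ∈ ends e, p v ≤ w e
      · have : e ∈ M₁ := Finset.mem_filter.2 ⟨he, hYZ, hw⟩
        rw [if_pos this]
        linarith
      · have : e ∉ M₁ := fun h => hw (Finset.mem_filter.1 h).2.2
        rw [if_neg this]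
        linarith
  have hres : ∑ e ∈ M₁, (w e - ∑ v ∈ ends e, p v) + totalGain (run ends w η Y)
      ≤ 2 * (1 + η) * totalGain (run ends w η (X ++ Y)) := by
    refine sum_residual_add_totalGain_le hη hc (hM.subset (by exact_mod_cast hM₁))
      (fun e he => ?_) fun e he => (Finset.mem_filter.1 he).2.2
    have h1 := hMX e (hM₁ he)
    have h2 := (Finset.mem_filter.1 he).2.1
    simp only [List.mem_append] at h1 h2
    tauto
  have hsum : ∑ e ∈ M, w e ≤ 2 * (1 + η) * totalGain (run ends w η (Y ++ Z)) +
      ∑ e ∈ M₁, (w e - ∑ v ∈ ends e, p v) := by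
    refine (Finset.sum_le_sum hpt).trans ?_
    rw [Finset.sum_add_distrib, ← Finset.mul_sum, Finset.sum_ite_mem,
      Finset.inter_eq_right.2 hM₁]
    have := mul_le_mul_of_nonneg_left (sum_sum_ends_le hM hq0) (by linarith : 0 ≤ 1 + η)
    rw [show ∑ v, q v = 2 * totalGain (run ends w η (Y ++ Z)) from sum_potential hc _] at this
    linarith
  have hmono : totalGain (run ends w η Y) ≤ totalGain (run ends w η (Y ++ Z)) :=
    totalGain_run_mono hη Y Z
  have hF : 0 ≤ totalGain (run ends w η (Y ++ Z)) := (isStack_run hη _).totalGain_nonneg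
  have h3 := mul_le_mul_of_nonneg_left hsum (by linarith : 0 ≤ 1 - η)
  have h4 := mul_le_mul_of_nonneg_left hres (by linarith : 0 ≤ 1 - η)
  have h5 := mul_le_mul_of_nonneg_left hXY (by linarith : 0 ≤ 2 * (1 + η))
  have h6 := mul_le_mul_of_nonneg_left hmono (by linarith : 0 ≤ 1 + 3 * η)
  nlinarith [mul_nonneg (mul_nonneg hη hη) hF]

end Approximation

/-! ### Forgetting light edges of the stack -/

section Truncation

variable {V E : Type} [DecidableEq V] (ends : E → Finset V) (w : E → ℝ) (η : ℝ)

/-- An edge is worth keeping if its weight is not negligible against the potentials of its ends. -/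
def Keep (φ : V → ℝ) (e : E) : Prop := ∀ v ∈ ends e, η * φ v < w e

variable {ends w η}

/-- The gains of the light edges at one vertex sum up to at most the threshold: the weight of the
newest one bounds its gain and all the older ones. -/
lemma IsStack.sum_light_le {l : List (E × ℝ)} (h : IsStack ends w l) {τ : ℝ} (hτ : 0 ≤ τ) (v : V)
    [∀ e, Decidable (w e ≤ τ)] :
    (l.map fun p => if v ∈ ends p.1 ∧ w p.1 ≤ τ then p.2 else 0).sum ≤ τ ∧
    (l.map fun p => if v ∈ ends p.1 ∧ w p.1 ≤ τ then p.2 else 0).sum ≤ potential ends l v := by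
  induction l with
  | nil => simpa
  | cons p l ih =>
    obtain ⟨ih1, ih2⟩ := ih h.2.2
    obtain ⟨h0, h1, h2⟩ := h
    rw [List.map_cons, List.sum_cons, potential_cons]
    by_cases hv : v ∈ ends p.1
    · have := Finset.single_le_sum (f := fun u => potential ends l u)
        (fun u _ => h2.potential_nonneg u) hv
      by_cases hw : w p.1 ≤ τ
      · rw [if_pos ⟨hv, hw⟩, if_pos hv]
        constructor <;> linarith
      · rw [if_neg (by tauto), if_pos hv]
        constructor <;> linarith
    · rw [if_neg (by tauto), if_neg hv]
      constructor <;> linarith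

open Classical in
/-- Keeping only the heavy edges costs at most the fraction `2 * η` of the gain. -/
lemma IsStack.le_totalGain_filter [Fintype V] (hc : ∀ e, (ends e).card = 2) (hη : 0 ≤ η)
    {l : List (E × ℝ)} (h : IsStack ends w l) :
    (1 - 2 * η) * totalGain l ≤
      totalGain (l.filter fun p => Keep ends w η (potential ends l) p.1) := by
  set φ := potential ends l
  have key : ∀ k : List (E × ℝ), (∀ p ∈ k, 0 ≤ p.2) →
      totalGain k ≤ totalGain (k.filter fun p => Keep ends w η φ p.1) +
        ∑ v, (k.map fun p => if v ∈ ends p.1 ∧ w p.1 ≤ η * φ v then p.2 else 0).sum := by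
    intro k hk
    induction k with
    | nil => simp
    | cons p k ih =>
      have ih' := ih fun q hq => hk q (List.mem_cons_of_mem _ hq)
      have h0 := hk p List.mem_cons_self
      simp only [List.map_cons, List.sum_cons, Finset.sum_add_distrib, totalGain_cons]
      have hpos : ∀ v ∈ Finset.univ,
          0 ≤ if v ∈ ends p.1 ∧ w p.1 ≤ η * φ v then p.2 else 0 := by
        intro v _
        split_ifs <;> linarith
      by_cases hK : Keep ends w η φ p.1
      · rw [List.filter_cons_of_pos (by simpa using hK), totalGain_cons]
        linarith [Finset.sum_nonneg hpos]
      · rw [List.filter_cons_of_neg (by simpa using hK)]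
        simp only [Keep, not_forall, not_lt] at hK
        obtain ⟨v, hv, hw⟩ := hK
        have := Finset.single_le_sum hpos (Finset.mem_univ v)
        rw [if_pos ⟨hv, hw⟩] at this
        linarith
  have hpos : ∀ p ∈ l, 0 ≤ p.2 := by
    clear key
    clear_value φ
    induction l with
    | nil => simp
    | cons q l ih =>
      intro p hp
      rcases List.mem_cons.1 hp with rfl | hp
      · exact h.1
      · exact ih h.2.2 p hp
  have hlight : ∑ v, (l.map fun p => if v ∈ ends p.1 ∧ w p.1 ≤ η * φ v then p.2 else 0).sum
      ≤ ∑ v, η * φ v :=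
    Finset.sum_le_sum fun v _ => (h.sum_light_le (mul_nonneg hη (h.potential_nonneg v)) v).1
  rw [← Finset.mul_sum, sum_potential hc] at hlight
  linarith [key l hpos]

open Classical in
/-- Each push at `v` multiplies the potential of `v` by at least `1 + η`, and the first push of an
edge heavier than `τ` lifts it to about `η * τ`. -/
lemma IsSteep.pow_countP_lt (hη : 0 < η) {l : List (E × ℝ)} (h : IsStack ends w l)
    (hs : IsSteep ends w η l) {τ : ℝ} (v : V)
    (hn : (l.countP fun p => v ∈ ends p.1 ∧ τ < w p.1) ≠ 0) :
    η * τ * (1 + η) ^ (l.countP fun p => v ∈ ends p.1 ∧ τ < w p.1)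
      < (1 + η) ^ 2 * potential ends l v := by
  induction l with
  | nil => simp at hn
  | cons p l ih =>
    obtain ⟨h0, h1, h2⟩ := h
    obtain ⟨s0, s1, s2⟩ := hs
    rw [potential_cons]
    by_cases hp : v ∈ ends p.1 ∧ τ < w p.1
    · rw [List.countP_cons_of_pos (by simpa using hp), if_pos hp.1]
      have hP := h2.potential_nonneg (v := v)
      by_cases hl : (l.countP fun p => v ∈ ends p.1 ∧ τ < w p.1) = 0
      · rw [hl, zero_add, pow_one]
        have := mul_lt_mul_of_pos_left hp.2 hη
        have h3 : 0 ≤ (1 + η) * potential ends l v := mul_nonneg (by linarith) hP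
        nlinarith
      · have ih' := ih h2 s2 hl
        have hsum := Finset.single_le_sum (f := fun u => potential ends l u)
          (fun u _ => h2.potential_nonneg u) hp.1
        have h3 := mul_le_mul_of_nonneg_left hsum hη.le
        have h4 : (1 + η) * potential ends l v ≤ p.2 + potential ends l v := by
          linarith
        calc _ = (1 + η) * (η * τ * (1 + η) ^ (l.countP fun p => v ∈ ends p.1 ∧ τ < w p.1)) := by
              ring
          _ < (1 + η) * ((1 + η) ^ 2 * potential ends l v) :=
              mul_lt_mul_of_pos_left ih' (by linarith)
          _ = (1 + η) ^ 2 * ((1 + η) * potential ends l v) := by ring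
          _ ≤ _ := mul_le_mul_of_nonneg_left h4 (by positivity)
    · rw [List.countP_cons_of_neg (by simpa using hp)] at hn ⊢
      refine (ih h2 s2 hn).trans_le (mul_le_mul_of_nonneg_left ?_ (by positivity))
      split_ifs <;> linarith

open Classical in
/-- Few heavy edges are left at each vertex. -/
lemma IsSteep.pow_countP_keep_le (hη : 0 < η) {l : List (E × ℝ)} (h : IsStack ends w l)
    (hs : IsSteep ends w η l) (v : V) :
    (1 + η) ^ (l.countP fun p => v ∈ ends p.1 ∧ η * potential ends l v < w p.1)
      ≤ ((1 + η) / η) ^ 2 := by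
  by_cases hn : (l.countP fun p => v ∈ ends p.1 ∧ η * potential ends l v < w p.1) = 0
  · rw [hn, pow_zero]
    refine one_le_pow₀ ?_
    rw [le_div_iff₀ hη]
    linarith
  · have := hs.pow_countP_lt hη h v hn
    have hP : 0 < potential ends l v := by
      refine (h.potential_nonneg v).lt_of_ne fun h0 => ?_
      rw [← h0] at this
      simp at this
    rw [div_pow, le_div_iff₀ (by positivity)]
    refine le_of_lt (lt_of_mul_lt_mul_right ?_ hP.le)
    calc _ = η * (η * potential ends l v) *
          (1 + η) ^ (l.countP fun p => v ∈ ends p.1 ∧ η * potential ends l v < w p.1) := by ring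
      _ < _ := this

open Classical in
lemma length_filter_keep_le [Fintype V] (hne : ∀ e, (ends e).Nonempty) (φ : V → ℝ)
    (l : List (E × ℝ)) :
    (l.filter fun p => Keep ends w η φ p.1).length ≤
      ∑ v, l.countP fun p => v ∈ ends p.1 ∧ η * φ v < w p.1 := by
  induction l with
  | nil => simp
  | cons p l ih =>
    simp only [List.countP_cons, Finset.sum_add_distrib]
    by_cases hK : Keep ends w η φ p.1
    · rw [List.filter_cons_of_pos (by simpa using hK), List.length_cons]
      obtain ⟨v, hv⟩ := hne p.1
      have := Finset.single_le_sum (f := fun v =>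
        if decide (v ∈ ends p.1 ∧ η * φ v < w p.1) = true then 1 else 0)
        (fun _ _ => Nat.zero_le _) (Finset.mem_univ v)
      simp only [hv, hK v hv, and_self, decide_true, if_true] at this
      exact Nat.add_le_add ih this
    · rw [List.filter_cons_of_neg (by simpa using hK)]
      omega

end Truncation

end LocalRatio

namespace SmoothHistogram

/-! ### Thinning out a list of buckets -/

section Prune

variable {α : Type} (f : α → ℝ) (c : ℝ)

open Classical in
/-- Put `b` in front of a list and delete the second entry as long as the third one has at least
`c` times the value of `b`. -/
noncomputable def insertPruned (b : α) : List α → List α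
  | x :: d :: l => if c * f b ≤ f d then insertPruned b (d :: l) else b :: x :: d :: l
  | l => b :: l

/-- Thin out a list so that values drop by the factor `c` every two entries. The first and the last
entry survive. -/
noncomputable def prune (l : List α) : List α := l.foldr (insertPruned f c) []

/-- Along the list, values drop by the factor `c` every two entries. -/
def Sparse : List α → Prop
  | x :: y :: z :: l => f z < c * f x ∧ Sparse (y :: z :: l)
  | _ => True

variable {f c}

lemma insertPruned_induction {b : α} {P : List α → List α → Prop}
    (h0 : P [] [b]) (h1 : ∀ x, P [x] [b, x])
    (h2 : ∀ x d l, c * f b ≤ f d → P (d :: l) (insertPruned f c b (d :: l)) →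
      P (x :: d :: l) (insertPruned f c b (d :: l)))
    (h3 : ∀ x d l, f d < c * f b → P (x :: d :: l) (b :: x :: d :: l)) :
    ∀ l, P l (insertPruned f c b l)
  | [] => by simpa [insertPruned] using h0
  | [x] => by simpa [insertPruned] using h1 x
  | x :: d :: l => by
    rw [insertPruned]
    split_ifs with h
    · exact h2 x d l h (insertPruned_induction h0 h1 h2 h3 (d :: l))
    · exact h3 x d l (not_le.1 h)

lemma insertPruned_spec {R : α → α → Prop}
    (hR : ∀ b x d, R b x → R x d → c * f b ≤ f d → R b d) (b : α) (l : List α) :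
    (insertPruned f c b l).head? = some b ∧
    (insertPruned f c b l).getLast? = (b :: l).getLast? ∧
    (insertPruned f c b l).Sublist (b :: l) ∧
    (Sparse f c l → Sparse f c (insertPruned f c b l)) ∧
    ((b :: l).IsChain R → (insertPruned f c b l).IsChain R) := by
  induction l using insertPruned_induction (f := f) (c := c) (b := b) with
  | h0 => simp [Sparse]
  | h1 x => simp [Sparse]
  | h2 x d l hd ih =>
    obtain ⟨i1, i2, i3, i4, i5⟩ := ih
    refine ⟨i1, ?_, ?_, fun h => i4 ?_, fun h => i5 ?_⟩
    · rw [i2]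
      simp
    · exact i3.trans ((List.sublist_cons_self _ _).cons_cons _)
    · cases l with
      | nil => trivial
      | cons y l => exact h.2
    · simp only [List.isChain_cons_cons] at h ⊢
      exact ⟨hR b x d h.1 h.2.1 hd, h.2.2⟩
  | h3 x d l hd => exact ⟨rfl, rfl, List.Sublist.refl _, fun h => ⟨hd, h⟩, id⟩

lemma prune_spec {R : α → α → Prop}
    (hR : ∀ b x d, R b x → R x d → c * f b ≤ f d → R b d) (l : List α) :
    (prune f c l).head? = l.head? ∧ (prune f c l).getLast? = l.getLast? ∧
    (prune f c l).Sublist l ∧ Sparse f c (prune f c l) ∧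
    (l.IsChain R → (prune f c l).IsChain R) := by
  induction l with
  | nil => simp [prune, Sparse]
  | cons b l ih =>
    obtain ⟨i1, i2, i3, i4, i5⟩ := ih
    obtain ⟨j1, j2, j3, j4, j5⟩ := insertPruned_spec hR b (prune f c l)
    refine ⟨j1, j2.trans ?_, j3.trans (i3.cons_cons b), j4 i4, fun h => j5 ?_⟩
    · rw [List.getLast?_cons, List.getLast?_cons, i2]
    · rw [List.isChain_cons] at h ⊢
      rw [i1]
      exact ⟨h.1, i5 h.2⟩

lemma insertPruned_map {β : Type} (h : β → α) (b : β) (l : List β) :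
    insertPruned f c (h b) (l.map h) = (insertPruned (f ∘ h) c b l).map h := by
  induction l using insertPruned_induction (f := f ∘ h) (c := c) (b := b) with
  | h0 => simp [insertPruned]
  | h1 x => simp [insertPruned]
  | h2 x d l hd ih =>
    rw [← ih, List.map_cons, List.map_cons, insertPruned]
    exact if_pos hd
  | h3 x d l hd =>
    rw [List.map_cons, List.map_cons, insertPruned]
    exact if_neg (not_le.2 hd)

lemma prune_map {β : Type} (h : β → α) (l : List β) :
    prune f c (l.map h) = (prune (f ∘ h) c l).map h := by
  induction l with
  | nil => simp [prune]
  | cons b l ih =>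
    have ih' : List.foldr (insertPruned f c) [] (l.map h) = _ := ih
    rw [List.map_cons, prune, List.foldr_cons, ih', insertPruned_map]
    rfl

lemma Sparse.of_append_singleton {l : List α} {z : α} (h : Sparse f c (l ++ [z])) :
    Sparse f c l := by
  induction l using Sparse.induct with
  | case1 x y z l ih => exact ⟨h.1, ih h.2⟩
  | case2 l hl =>
    rcases l with _ | ⟨x, _ | ⟨y, _ | ⟨z, l⟩⟩⟩
    · trivial
    · trivial
    · trivial
    · exact absurd rfl (hl x y z l)

/-- A sparse list of values in `[m, B]` is short. -/
lemma Sparse.length_le {η m B : ℝ} (hη1 : η < 1) (hm : 0 < m)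
    {l : List α} (h : Sparse f (1 - η) l) (hl : ∀ x ∈ l, m ≤ f x ∧ f x ≤ B) (hB : m ≤ B)
    (hη : 0 ≤ η) : l.length * η ≤ 2 * Real.log (B / m) + 2 * η := by
  have hlog : ∀ x ∈ l, Real.log (f x / m) ≤ Real.log (B / m) := fun x hx =>
    Real.log_le_log (div_pos (hm.trans_le (hl x hx).1) hm)
      (div_le_div_of_nonneg_right (hl x hx).2 hm.le)
  have h0 : 0 ≤ Real.log (B / m) := Real.log_nonneg ((one_le_div hm).2 hB)
  have key : ∀ l : List α, Sparse f (1 - η) l → (∀ x ∈ l, m ≤ f x) → ∀ x y r, l = x :: y :: r →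
      r.length * η ≤ Real.log (f x / m) + Real.log (f y / m) := by
    intro l hs hm'
    induction l using Sparse.induct with
    | case1 x y z l ih =>
      rintro _ _ _ ⟨⟩
      have h1 := ih hs.2 (fun u hu => hm' u (List.mem_cons_of_mem _ hu)) y z l rfl
      have hz : 0 < f z := hm.trans_le (hm' z (by simp))
      have hx : 0 < f x := hm.trans_le (hm' x (by simp))
      have h2 : Real.log (f z / m) ≤ Real.log ((1 - η) * (f x / m)) := by
        refine Real.log_le_log (div_pos hz hm) ?_
        rw [← mul_div_assoc]
        exact div_le_div_of_nonneg_right hs.1.le hm.le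
      rw [Real.log_mul (by linarith) (div_pos hx hm).ne'] at h2
      have h3 := Real.log_le_sub_one_of_pos (by linarith : 0 < 1 - η)
      rw [List.length_cons]
      push_cast
      linarith
    | case2 l hl' =>
      rintro x y r rfl
      rcases r with _ | ⟨z, r⟩
      · simp only [List.length_nil, Nat.cast_zero, zero_mul]
        refine add_nonneg ?_ ?_ <;> refine Real.log_nonneg ((one_le_div hm).2 (hm' _ (by simp)))
      · exact absurd rfl (hl' x y z r)
  rcases l with _ | ⟨x, _ | ⟨y, r⟩⟩
  · simp only [List.length_nil, Nat.cast_zero, zero_mul]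
    linarith
  · simp only [List.length_cons, List.length_nil, zero_add, Nat.cast_one, one_mul]
    linarith
  · have := key _ h (fun u hu => (hl u hu).1) x y r rfl
    have h1 := hlog x (by simp)
    have h2 := hlog y (by simp)
    simp only [List.length_cons]
    push_cast
    linarith

end Prune

end SmoothHistogram

namespace LocalRatio

/-! ### The bounded-memory summary of a run -/

section Summary

variable {V E : Type} [DecidableEq V] (ends : E → Finset V) (w : E → ℝ) (η : ℝ)

open Classical in
/-- One step of the local-ratio algorithm on a summary, which consists of the potentials and of the
heavy edges of the stack, newest first. -/
noncomputable def summaryStep (I : (V → ℝ) × List E) (e : E) : (V → ℝ) × List E :=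
  if (1 + η) * ∑ v ∈ ends e, I.1 v < w e then
    let φ : V → ℝ := fun v => (if v ∈ ends e then w e - ∑ u ∈ ends e, I.1 u else 0) + I.1 v
    (φ, (e :: I.2).filter fun a => Keep ends w η φ a)
  else I

/-- The summary after the edges of `X` have been processed in order. -/
noncomputable def summary (X : List E) : (V → ℝ) × List E :=
  X.foldl (summaryStep ends w η) (0, [])

variable {ends w η}

lemma summary_append_singleton (X : List E) (e : E) :
    summary ends w η (X ++ [e]) = summaryStep ends w η (summary ends w η X) e := by
  simp [summary]

open Classical in
/-- The summary determines the same run: since potentials only grow, an edge that has once become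
light stays light, so the heavy edges can be filtered incrementally. -/
lemma summary_eq (hη : 0 ≤ η) (X : List E) : summary ends w η X =
    (potential ends (run ends w η X),
      ((run ends w η X).filter fun p =>
        Keep ends w η (potential ends (run ends w η X)) p.1).map Prod.fst) := by
  induction X using List.reverseRecOn with
  | nil =>
    simp only [summary, run, List.foldl_nil, List.filter_nil, List.map_nil]
    congr 1
  | append_singleton X e ih =>
    have hmono := potential_run_mono (ends := ends) (w := w) hη X [e]
    rw [run_append_singleton] at hmono
    rw [summary_append_singleton, ih, run_append_singleton, summaryStep]
    by_cases hc : (1 + η) * ∑ v ∈ ends e, potential ends (run ends w η X) v < w e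
    · rw [if_pos hc]
      have hpush : push ends w η (run ends w η X) e =
        (e, w e - ∑ v ∈ ends e, potential ends (run ends w η X) v) :: run ends w η X := by
        rw [push, if_pos hc]
      have hφ : (fun v => (if v ∈ ends e then
          w e - ∑ u ∈ ends e, potential ends (run ends w η X) u else 0)
          + potential ends (run ends w η X) v) =
          potential ends (push ends w η (run ends w η X) e) := by
        funext v
        rw [hpush, potential_cons]
      have hlist : e :: List.map Prod.fst (List.filter (fun p : E × ℝ =>
            Keep ends w η (potential ends (run ends w η X)) p.1) (run ends w η X)) =
          List.map Prod.fst ((e, w e - ∑ v ∈ ends e, potential ends (run ends w η X) v) ::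
            List.filter (fun p : E × ℝ =>
              Keep ends w η (potential ends (run ends w η X)) p.1) (run ends w η X)) := by
        simp
      simp only [hφ, hlist, List.filter_map, Function.comp_def]
      congr 2
      conv_rhs => rw [hpush]
      simp only [List.filter_cons, List.filter_filter]
      have hfun : ∀ p : E × ℝ,
          (decide (Keep ends w η (potential ends (push ends w η (run ends w η X) e)) p.1) &&
            decide (Keep ends w η (potential ends (run ends w η X)) p.1)) =
          decide (Keep ends w η (potential ends (push ends w η (run ends w η X) e)) p.1) := by
        intro p
        rw [← Bool.decide_and, decide_eq_decide]
        refine and_iff_left_of_imp fun h v hv => lt_of_le_of_lt ?_ (h v hv)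
        exact mul_le_mul_of_nonneg_left (hmono v) hη
      simp only [hfun]
      rw [← hpush]
    · rw [if_neg hc, push, if_neg hc]

end Summary

end LocalRatio

namespace SmoothHistogram

open LocalRatio

/-! ### The smooth histogram over a sliding window -/

section Window

variable {I : Type}

lemma slidingWindow_succ_append (a : ℕ) (s : List I) (e : I) :
    slidingWindow (a + 1) (s ++ [e]) = slidingWindow a s ++ [e] := by
  unfold slidingWindow
  rw [List.length_append, List.length_singleton, Nat.add_sub_add_right,
    List.drop_append_of_le_length (Nat.sub_le _ _)]

lemma slidingWindow_suffix {a b : ℕ} (h : a ≤ b) (s : List I) :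
    slidingWindow a s <:+ slidingWindow b s := by
  unfold slidingWindow
  rw [show s.length - a = (s.length - b) + ((s.length - a) - (s.length - b)) by omega,
    ← List.drop_drop]
  exact List.drop_suffix _ _

@[simp] lemma slidingWindow_zero (s : List I) : slidingWindow 0 s = [] := by
  simp [slidingWindow]

lemma length_slidingWindow {a : ℕ} {s : List I} (h : a ≤ s.length) :
    (slidingWindow a s).length = a := by
  rw [slidingWindow, List.length_drop]
  omega

end Window

section Histogram

variable {V E : Type} [DecidableEq V] (ends : E → Finset V) (w : E → ℝ) (η : ℝ) (L : ℕ)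

/-- Delete the first bucket if its age exceeds `L`. -/
def expire {α : Type} (age : α → ℕ) : List α → List α
  | [] => []
  | b :: l => if L < age b then l else b :: l

/-- The lists `T` (all edges) and `T'` (the edges of a younger bucket) can be written as
`X ++ Y ++ Z` and `Y ++ Z` such that the run on `Y` had nearly the gain of the run on `X ++ Y`:
before the edges of `Z` arrived, the younger bucket could replace the run on all edges. -/
def Certified (T T' : List E) : Prop :=
  ∃ X Y Z, T = X ++ Y ++ Z ∧ T' = Y ++ Z ∧
    (1 - η) * totalGain (run ends w η (X ++ Y)) ≤ totalGain (run ends w η Y)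

/-- The relation between the ages `a` and `d` of neighbouring buckets. -/
def Link (s : List E) (a d : ℕ) : Prop :=
  d < a ∧ (a = d + 1 ∨ Certified ends w η (slidingWindow a s) (slidingWindow d s))

variable {ends w η L}

lemma Certified.append_singleton {T T' : List E} (h : Certified ends w η T T') (e : E) :
    Certified ends w η (T ++ [e]) (T' ++ [e]) := by
  obtain ⟨X, Y, Z, h1, h2, h3⟩ := h
  exact ⟨X, Y, Z ++ [e], by simp [h1], by simp [h2], h3⟩

lemma certified_self (hη : 0 ≤ η) (T : List E) : Certified ends w η T T := by
  refine ⟨[], T, [], by simp, by simp, ?_⟩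
  have := (isStack_run (ends := ends) (w := w) hη T).totalGain_nonneg
  rw [List.nil_append]
  nlinarith

lemma Link.succ {s : List E} {a d : ℕ} (h : Link ends w η s a d) (e : E) :
    Link ends w η (s ++ [e]) (a + 1) (d + 1) := by
  refine ⟨by have := h.1; omega, h.2.imp (fun h => by omega) fun h => ?_⟩
  rw [slidingWindow_succ_append, slidingWindow_succ_append]
  exact h.append_singleton e

lemma expire_map {α β : Type} (age : β → ℕ) (h : α → β) (l : List α) :
    expire L age (l.map h) = (expire L (age ∘ h) l).map h := by
  cases l with
  | nil => rfl
  | cons b l =>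
    simp only [expire, List.map_cons, Function.comp]
    split_ifs <;> rfl

variable [Fintype V] (ends w η L)

/-- The state of the sliding-window algorithm: a list of buckets, oldest first. A bucket is its age,
which is the number of most recent edges that it covers, with the summary of the run on
these edges. -/
abbrev State (V E : Type) : Type := List (ℕ × (V → ℝ) × List E)

/-- Feed `e` to every bucket, open an empty bucket, drop the first bucket if it has left the
window, and prune with respect to the sum of the potentials. -/
noncomputable def histogramStep (st : State V E) (e : E) : State V E :=
  prune (fun b => ∑ v, b.2.1 v) (1 - η) (expire L Prod.fst
    (st.map (fun b => (b.1 + 1, summaryStep ends w η b.2 e)) ++ [(0, 0, [])]))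

/-- The state after the stream `s`. The initial state is one empty bucket. -/
noncomputable def histogram (s : List E) : State V E :=
  s.foldl (histogramStep ends w η L) [(0, 0, [])]

/-- Unwind the heavy edges of the oldest bucket. -/
noncomputable def histogramReport : State V E → Finset E
  | [] => ∅
  | b :: _ => greedy ends b.2.2 ∅

/-- The bucket of age `a` after the stream `s`. -/
noncomputable def bucket (s : List E) (a : ℕ) : ℕ × (V → ℝ) × List E :=
  (a, summary ends w η (slidingWindow a s))

/-- What holds for the ages of the buckets after the stream `s`. -/
structure Invariant (s : List E) (ages : List ℕ) : Prop where
  chain : ages.IsChain (Link ends w η s)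
  last : ages.getLast? = some 0
  head : ∀ a ∈ ages.head?, ∃ T, slidingWindow L s <:+ T ∧
    Certified ends w η T (slidingWindow a s)
  le_length : ∀ a ∈ ages, a ≤ s.length
  le_window : ∀ a ∈ ages, a ≤ L
  sparse : Sparse (fun a => ∑ v, (bucket ends w η s a).2.1 v) (1 - η) ages

variable {ends w η L}

lemma sum_bucket (hη : 0 ≤ η) (hc : ∀ e, (ends e).card = 2) (s : List E) (a : ℕ) :
    ∑ v, (bucket ends w η s a).2.1 v
      = 2 * totalGain (run ends w η (slidingWindow a s)) := by
  rw [bucket, summary_eq hη]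
  exact sum_potential hc _

lemma Link.trans_of_smooth (hη : 0 ≤ η) (hc : ∀ e, (ends e).card = 2) {s : List E} {a b d : ℕ}
    (h1 : Link ends w η s a b) (h2 : Link ends w η s b d)
    (h : (1 - η) * ∑ v, (bucket ends w η s a).2.1 v ≤ ∑ v, (bucket ends w η s d).2.1 v) :
    Link ends w η s a d := by
  have hda : d < a := h2.1.trans h1.1
  refine ⟨hda, Or.inr ?_⟩
  obtain ⟨X, hX⟩ := slidingWindow_suffix hda.le s
  refine ⟨X, slidingWindow d s, [], by simp [hX], by simp, ?_⟩
  rw [sum_bucket hη hc, sum_bucket hη hc] at h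
  rw [hX]
  linarith

/-- The ages of the buckets after the next edge, before pruning. -/
lemma Invariant.expire_spec (hη : 0 ≤ η) {s : List E} {ages : List ℕ}
    (h : Invariant ends w η L s ages) (hL : 1 ≤ L) (e : E) :
    (expire L id (ages.map (· + 1) ++ [0])).IsChain (Link ends w η (s ++ [e])) ∧
    (expire L id (ages.map (· + 1) ++ [0])).getLast? = some 0 ∧
    (∀ a ∈ (expire L id (ages.map (· + 1) ++ [0])).head?, ∃ T,
      slidingWindow L (s ++ [e]) <:+ T ∧
        Certified ends w η T (slidingWindow a (s ++ [e]))) ∧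
    (∀ a ∈ expire L id (ages.map (· + 1) ++ [0]), a ≤ (s ++ [e]).length) ∧
    (∀ a ∈ expire L id (ages.map (· + 1) ++ [0]), a ≤ L) := by
  obtain ⟨hchain, hlast, hhead, hlen, hwin, -⟩ := h
  have hch : (ages.map (· + 1) ++ [0]).IsChain (Link ends w η (s ++ [e])) := by
    rw [List.isChain_append]
    refine ⟨List.isChain_map_of_isChain _ (fun a b hab => hab.succ e) hchain, by simp, ?_⟩
    intro x hx y hy
    rw [List.getLast?_map, hlast] at hx
    simp only [Option.map_some, Option.mem_def, Option.some.injEq, List.head?_cons] at hx hy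
    subst hx hy
    exact ⟨by omega, Or.inl rfl⟩
  have hpw : (ages.map (· + 1) ++ [0]).Pairwise (· > ·) :=
    List.isChain_iff_pairwise.1 (hch.imp fun a b hab => hab.1)
  have hle : ∀ a ∈ ages.map (· + 1) ++ [0], a ≤ (s ++ [e]).length := by
    intro a ha
    rw [List.mem_append, List.mem_map] at ha
    rcases ha with ⟨b, hb, rfl⟩ | ha
    · have := hlen b hb
      rw [List.length_append, List.length_singleton]
      omega
    · simp at ha
      omega
  rcases ages with _ | ⟨a, l⟩
  · simp at hlast
  simp only [List.map_cons, List.cons_append] at hch hpw hle ⊢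
  have haL := hwin a List.mem_cons_self
  rw [List.pairwise_cons] at hpw
  unfold expire
  simp only [id]
  split_ifs with hexp
  · obtain rfl : a = L := by omega
    rw [List.isChain_cons] at hch
    refine ⟨hch.2, by simp, fun d hd => ?_, fun x hx => hle x (List.mem_cons_of_mem _ hx),
      fun x hx => by have := hpw.1 x hx; omega⟩
    obtain ⟨-, hd | hd⟩ := hch.1 d hd
    · obtain rfl : a = d := by omega
      exact ⟨_, List.suffix_rfl, certified_self hη _⟩
    · exact ⟨_, slidingWindow_suffix (Nat.le_succ a) _, hd⟩
  · refine ⟨hch, by simp [List.getLast?_cons], ?_, hle, ?_⟩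
    · rintro x hx
      obtain rfl : a + 1 = x := by simpa using hx
      obtain ⟨T, hT, hC⟩ := hhead a (by simp)
      refine ⟨T ++ [e], ?_, ?_⟩
      · refine (slidingWindow_suffix (Nat.le_succ L) _).trans ?_
        rw [slidingWindow_succ_append]
        obtain ⟨T', rfl⟩ := hT
        exact ⟨T', by simp⟩
      · rw [slidingWindow_succ_append]
        exact hC.append_singleton e
    · intro x hx
      rcases List.mem_cons.1 hx with rfl | hx
      · omega
      · have := hpw.1 x hx
        omega

lemma exists_invariant (hη : 0 ≤ η) (hc : ∀ e, (ends e).card = 2) (hL : 1 ≤ L) (s : List E) :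
    ∃ ages, histogram ends w η L s = ages.map (bucket ends w η s) ∧
      Invariant ends w η L s ages := by
  induction s using List.reverseRecOn with
  | nil =>
    refine ⟨[0], by simp [histogram, bucket, summary, slidingWindow], by simp, by simp, ?_, by simp,
      by simp, trivial⟩
    rintro a -
    exact ⟨[], by simp [slidingWindow], by simpa [slidingWindow] using certified_self hη _⟩
  | append_singleton s e ih =>
    obtain ⟨ages, h1, h2⟩ := ih
    obtain ⟨c1, c2, c3, c4, c5⟩ := h2.expire_spec hη hL e
    obtain ⟨p1, p2, p3, p4, p5⟩ := prune_spec (c := 1 - η)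
      (f := fun a => ∑ v, (bucket ends w η (s ++ [e]) a).2.1 v)
      (R := Link ends w η (s ++ [e])) (fun _ _ _ => Link.trans_of_smooth hη hc)
      (expire L id (ages.map (· + 1) ++ [0]))
    refine ⟨_, ?_, p5 c1, p2.trans c2, fun a ha => c3 a (p1 ▸ ha),
      fun a ha => c4 a (p3.subset ha), fun a ha => c5 a (p3.subset ha), p4⟩
    have hmap : (ages.map (bucket ends w η s)).map
          (fun b => (b.1 + 1, summaryStep ends w η b.2 e)) ++ [(0, 0, [])]
        = (ages.map (· + 1) ++ [0]).map (bucket ends w η (s ++ [e])) := by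
      rw [List.map_append, List.map_map, List.map_map]
      congr 1
      · refine List.map_congr_left fun a _ => ?_
        simp only [Function.comp, bucket]
        rw [slidingWindow_succ_append, summary_append_singleton]
      · simp [bucket, summary]
    rw [histogram, List.foldl_append, List.foldl_cons, List.foldl_nil]
    rw [histogram] at h1
    rw [h1, histogramStep, hmap, expire_map, prune_map]
    rfl

/-- The report of the histogram is a matching in the window whose weight is, up to factors close
to `1`, at least a third of the optimum. -/
theorem histogramReport_spec (hη : 0 ≤ η) (hη1 : η ≤ 1 / 2) (hc : ∀ e, (ends e).card = 2)
    (hL : 1 ≤ L) (s : List E) :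
    (∀ e ∈ histogramReport ends (histogram ends w η L s), e ∈ slidingWindow L s) ∧
    (histogramReport ends (histogram ends w η L s) : Set E).PairwiseDisjoint ends ∧
    ∀ M : Finset E, (M : Set E).PairwiseDisjoint ends → (∀ e ∈ M, e ∈ slidingWindow L s) →
      (1 - 2 * η) * ((1 - η) * ∑ e ∈ M, w e) ≤
        3 * (1 + η) * ∑ e ∈ histogramReport ends (histogram ends w η L s), w e := by
  classical
  have hne : ∀ e, (ends e).Nonempty := fun e => Finset.card_pos.1 (by rw [hc]; norm_num)
  obtain ⟨ages, hages, hinv⟩ := exists_invariant (w := w) hη hc hL s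
  rcases ages with _ | ⟨a, l⟩
  · simpa using hinv.last
  rw [hages, List.map_cons]
  simp only [histogramReport, bucket]
  rw [summary_eq hη]
  simp only
  set k := run ends w η (slidingWindow a s) with hk
  have hkS : IsStack ends w k := isStack_run hη _
  refine ⟨fun e he => ?_, greedy_pairwiseDisjoint _ _, fun M hM hMs => ?_⟩
  · obtain ⟨p, hp, rfl⟩ := List.mem_map.1 (mem_of_mem_greedy he).1
    exact (slidingWindow_suffix (hinv.le_window a (by simp)) s).subset
      (mem_of_mem_run (List.mem_of_mem_filter hp))
  · obtain ⟨T, hT, X, Y, Z, rfl, hYZ, hXY⟩ := hinv.head a (by simp)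
    have h1 := sum_weight_le_of_smooth hη (by linarith) hc hXY hM fun e he =>
      hT.subset (hMs e he)
    rw [← hYZ, ← hk] at h1
    have h2 := hkS.le_totalGain_filter hc hη
    have h3 := le_sum_greedy hne (hkS.sublist (List.filter_sublist
      (p := fun p => decide (Keep ends w η (potential ends k) p.1)))).1 ∅
    rw [Finset.sum_empty, sub_zero] at h3
    have h4 := mul_le_mul_of_nonneg_left h1 (by linarith : 0 ≤ 1 - 2 * η)
    have h5 := mul_le_mul_of_nonneg_left (h2.trans h3) (by linarith : 0 ≤ 3 * (1 + η))
    linarith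

end Histogram

end SmoothHistogram

/-! ### Self-delimiting codes and the memory of an algorithm -/

namespace BitCode

variable {α β : Type}

/-- A code is self-delimiting if a code word can be read off the beginning of a longer string. -/
def SelfDelimiting (c : α → List Bool) : Prop :=
  ∀ a b x y, c a ++ x = c b ++ y → a = b ∧ x = y

lemma SelfDelimiting.injective {c : α → List Bool} (h : SelfDelimiting c) :
    Function.Injective c := fun a b hab => (h a b [] [] (by rw [hab])).1

lemma SelfDelimiting.comp {c : α → List Bool} (h : SelfDelimiting c) {f : β → α}
    (hf : Function.Injective f) : SelfDelimiting (c ∘ f) := fun _ _ x y hab =>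
  (h _ _ x y hab).imp_left fun h => hf h

lemma SelfDelimiting.prod {c : α → List Bool} {d : β → List Bool} (hc : SelfDelimiting c)
    (hd : SelfDelimiting d) : SelfDelimiting fun p : α × β => c p.1 ++ d p.2 := by
  rintro ⟨a, a'⟩ ⟨b, b'⟩ x y h
  simp only [List.append_assoc] at h
  obtain ⟨rfl, h'⟩ := hc _ _ _ _ h
  obtain ⟨rfl, rfl⟩ := hd _ _ _ _ h'
  exact ⟨rfl, rfl⟩

/-- Code a list by marking each entry with a leading `true` and the end with `false`. -/
def listCode (c : α → List Bool) (l : List α) : List Bool :=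
  l.flatMap (fun a => true :: c a) ++ [false]

lemma SelfDelimiting.listCode {c : α → List Bool} (hc : SelfDelimiting c) :
    SelfDelimiting (listCode c) := by
  intro l
  induction l with
  | nil =>
    rintro (_ | ⟨b, l'⟩) x y h
    · simpa [BitCode.listCode] using h
    · simp [BitCode.listCode] at h
  | cons a l ih =>
    rintro (_ | ⟨b, l'⟩) x y h
    · simp [BitCode.listCode] at h
    · simp only [BitCode.listCode, List.flatMap_cons, List.cons_append, List.append_assoc,
        List.cons.injEq, true_and] at h
      obtain ⟨rfl, h'⟩ := hc _ _ _ _ h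
      obtain ⟨rfl, rfl⟩ := ih l' x y (by simpa [BitCode.listCode] using h')
      exact ⟨rfl, rfl⟩

lemma length_listCode_le {c : α → List Bool} {l : List α} {B : ℝ}
    (h : ∀ a ∈ l, ((c a).length : ℝ) ≤ B) :
    ((listCode c l).length : ℝ) ≤ l.length * (B + 1) + 1 := by
  induction l with
  | nil => simp [listCode]
  | cons a l ih =>
    have h1 := ih fun b hb => h b (List.mem_cons_of_mem _ hb)
    have h2 := h a List.mem_cons_self
    simp only [listCode, List.flatMap_cons, List.length_append, List.length_cons,
      List.length_nil] at h1 ⊢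
    push_cast at h1 ⊢
    linarith

/-- Code a natural number by its binary digits. -/
def natCode (m : ℕ) : List Bool := listCode (fun b => [b]) m.bits

lemma selfDelimiting_natCode : SelfDelimiting natCode := by
  have h : SelfDelimiting fun b : Bool => [b] := fun a b x y h => by simpa using h
  refine h.listCode.comp fun a b hab => ?_
  rw [← Nat.ofDigits_digits 2 a, ← Nat.ofDigits_digits 2 b, Nat.digits_two_eq_bits,
    Nat.digits_two_eq_bits, hab]

lemma length_natCode_le {m : ℕ} {x : ℝ} (hm : m ≤ x) (hx : 1 ≤ x) :
    ((natCode m).length : ℝ) ≤ 3 + 3 * Real.log x := by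
  have h := length_listCode_le (c := fun b : Bool => [b]) (l := m.bits) (B := 1) (by simp)
  have hlog := Real.log_nonneg hx
  rw [Nat.size_eq_bits_len] at h
  refine h.trans ?_
  rcases hs : m.size with _ | k
  · push_cast
    linarith
  · have h2 : (2 : ℝ) ^ k ≤ x := le_trans (by exact_mod_cast Nat.lt_size.1 (by omega)) hm
    have h3 := Real.log_le_log (by positivity) h2
    rw [Real.log_pow] at h3
    have h4 : (k : ℝ) * 0.69 ≤ k * Real.log 2 :=
      mul_le_mul_of_nonneg_left (by linarith [Real.log_two_gt_d9]) (Nat.cast_nonneg k)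
    push_cast
    linarith

/-- Code an element of a finite type by its number in some enumeration. -/
noncomputable def finiteCode (α : Type) [Finite α] (a : α) : List Bool :=
  natCode (Finite.equivFin α a)

lemma selfDelimiting_finiteCode [Finite α] : SelfDelimiting (finiteCode α) :=
  selfDelimiting_natCode.comp
    (f := fun a => (Finite.equivFin α a : ℕ))
    (Fin.val_injective.comp (Finite.equivFin α).injective)

lemma length_finiteCode_le [Finite α] {x : ℝ} (hx : 1 ≤ x) (h : (Nat.card α : ℝ) ≤ x) (a : α) :
    ((finiteCode α a).length : ℝ) ≤ 3 + 3 * Real.log x :=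
  length_natCode_le (le_trans (by exact_mod_cast (Finite.equivFin α a).2.le) h) hx

/-- A transition system whose reachable states have descriptions in `R` can be run by a streaming
algorithm that stores a shortest code word of a description. -/
theorem exists_streamingAlgorithm {I O Q R : Type} (q₀ : Q) (step : Q → I → Q) (report : Q → O)
    {enc : R → List Bool} (henc : Function.Injective enc) (dec : R → Q)
    (hdec : ∀ s : List I, ∃ r, dec r = s.foldl step q₀) :
    ∃ A : StreamingAlgorithm I O, ∀ s : List I,
      A.reportAfter s = report (s.foldl step q₀) ∧
      ∀ r, dec r = s.foldl step q₀ → (A.memory s).length ≤ (enc r).length := by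
  have hmin : ∀ q, ∃ r, (∃ r', dec r' = q) →
      dec r = q ∧ ∀ r', dec r' = q → (enc r).length ≤ (enc r').length := by
    intro q
    by_cases hq : ∃ r', dec r' = q
    · obtain ⟨r, h1, h2⟩ := WellFounded.has_min
        (measure fun r => (enc r).length).wf {r | dec r = q} hq
      exact ⟨r, fun _ => ⟨h1, fun r' hr' => not_lt.1 (h2 r' hr')⟩⟩
    · exact ⟨(hdec []).choose, fun h => absurd h hq⟩
  choose best hbest using hmin
  have : Nonempty R := ⟨best q₀⟩
  have hinv : ∀ r, Function.invFun enc (enc r) = r := Function.leftInverse_invFun henc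
  let A : StreamingAlgorithm I O :=
    { init := enc (best q₀)
      step := fun m e => enc (best (step (dec (Function.invFun enc m)) e))
      report := fun m => report (dec (Function.invFun enc m)) }
  have hmem : ∀ s, A.memory s = enc (best (s.foldl step q₀)) := by
    intro s
    induction s using List.reverseRecOn with
    | nil => rfl
    | append_singleton s e ih =>
      have : A.memory (s ++ [e]) = A.step (A.memory s) e := by
        simp [StreamingAlgorithm.memory]
      rw [this, ih]
      simp only [A, hinv, (hbest _ (hdec s)).1, List.foldl_append, List.foldl_cons,
        List.foldl_nil]
  refine ⟨A, fun s => ⟨?_, fun r hr => ?_⟩⟩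
  · rw [StreamingAlgorithm.reportAfter, hmem]
    simp only [A, hinv, (hbest _ (hdec s)).1]
  · rw [hmem]
    exact (hbest _ (hdec s)).2 r hr

end BitCode

/-! ### Rounding the weights -/

namespace Rounding

variable {η x y : ℝ}

/-- A power of two between `η * x / 2` and `η * x`. -/
noncomputable def unit (η x : ℝ) : ℝ := (2 : ℝ) ^ Int.log 2 (η * x)

/-- The largest multiple of `unit η x` that is at most `x`. -/
noncomputable def roundDown (η x : ℝ) : ℝ := unit η x * ⌊x / unit η x⌋₊

lemma unit_pos : 0 < unit η x := zpow_pos (by norm_num) _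

lemma unit_le (hη : 0 < η) (hx : 0 < x) : unit η x ≤ η * x := by
  simpa [unit] using Int.zpow_log_le_self (b := 2) (R := ℝ) (by norm_num) (mul_pos hη hx)

lemma lt_two_mul_unit : η * x < 2 * unit η x := by
  have := Int.lt_zpow_succ_log_self (b := 2) (R := ℝ) (by norm_num) (η * x)
  rw [zpow_add_one₀ (by norm_num)] at this
  rw [unit, mul_comm (2 : ℝ)]
  exact_mod_cast this

lemma roundDown_le (hx : 0 ≤ x) : roundDown η x ≤ x := by
  have := Nat.floor_le (div_nonneg hx (unit_pos (η := η) (x := x)).le)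
  rw [le_div_iff₀ unit_pos] at this
  rw [roundDown]
  linarith

lemma le_roundDown (hη : 0 < η) (hx : 0 < x) : (1 - η) * x ≤ roundDown η x := by
  have h1 := Nat.lt_floor_add_one (x / unit η x)
  rw [div_lt_iff₀ unit_pos] at h1
  have h2 := unit_le hη hx
  rw [roundDown]
  linarith

/-- Powers of two divide each other, so all rounded weights are multiples of the unit of the
smallest weight. -/
lemma roundDown_mem_zmultiples (hη : 0 < η) (hy : 0 < y) (hyx : y ≤ x) :
    roundDown η x ∈ AddSubgroup.zmultiples (unit η y) := by
  obtain ⟨k, hk⟩ := Int.le.dest (Int.log_mono_right (b := 2) (mul_pos hη hy)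
    (mul_le_mul_of_nonneg_left hyx hη.le))
  have : unit η x = (2 : ℝ) ^ k * unit η y := by
    rw [unit, unit, ← hk, zpow_add₀ (by norm_num), zpow_natCast, mul_comm]
  refine AddSubgroup.mem_zmultiples_iff.2 ⟨((2 ^ k * ⌊x / unit η x⌋₊ : ℕ) : ℤ), ?_⟩
  rw [roundDown, zsmul_eq_mul, Int.cast_natCast]
  generalize ⌊x / unit η x⌋₊ = m
  rw [this]
  push_cast
  ring

end Rounding

/-! ### Size of the state -/

namespace SmoothHistogram

open LocalRatio

section Size

variable {V E : Type} [DecidableEq V] {ends : E → Finset V} {w : E → ℝ} {η : ℝ}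

lemma potential_run_mem (G : AddSubgroup ℝ) {X : List E} (hw : ∀ e ∈ X, w e ∈ G) (v : V) :
    potential ends (run ends w η X) v ∈ G := by
  have hpot : ∀ l : List (E × ℝ), (∀ p ∈ l, p.2 ∈ G) → ∀ v, potential ends l v ∈ G := by
    intro l hl v
    refine list_sum_mem fun x hx => ?_
    obtain ⟨p, hp, rfl⟩ := List.mem_map.1 hx
    split_ifs
    · exact hl p hp
    · exact G.zero_mem
  refine hpot _ ?_ v
  induction X using List.reverseRecOn with
  | nil => simp [run]
  | append_singleton X e ih =>
    have ih' := ih fun e he => hw e (List.mem_append_left _ he)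
    rw [run_append_singleton, push]
    split_ifs
    · intro p hp
      rcases List.mem_cons.1 hp with rfl | hp
      · exact G.sub_mem (hw e (by simp)) (G.sum_mem fun v _ => hpot _ ih' v)
      · exact ih' p hp
    · exact ih'

lemma natCast_le_of_pow_le {c : ℕ} (hη : 0 < η) (hη1 : η ≤ 1)
    (h : (1 + η) ^ c ≤ ((1 + η) / η) ^ 2) : (c : ℝ) ≤ 4 / η * Real.log (2 / η) := by
  have h1 := Real.log_le_log (by positivity) h
  rw [Real.log_pow, Real.log_pow] at h1
  have h2 : η / 2 ≤ Real.log (1 + η) := by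
    have := Real.one_sub_inv_le_log_of_pos (by linarith : 0 < 1 + η)
    refine le_trans ?_ this
    rw [show 1 - (1 + η)⁻¹ = η / (1 + η) by field_simp; ring]
    gcongr
    linarith
  have h3 : Real.log ((1 + η) / η) ≤ Real.log (2 / η) :=
    Real.log_le_log (by positivity) (by gcongr; linarith)
  have h4 := mul_le_mul_of_nonneg_left h2 (Nat.cast_nonneg (α := ℝ) c)
  push_cast at h1
  rw [div_mul_eq_mul_div, le_div_iff₀ hη]
  linarith

variable [Fintype V]

lemma length_summary_le (hη : 0 < η) (hη1 : η ≤ 1) (hc : ∀ e, (ends e).card = 2) (X : List E) :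
    ((summary ends w η X).2.length : ℝ) ≤
      Fintype.card V * (4 / η * Real.log (2 / η)) := by
  classical
  have hne : ∀ e, (ends e).Nonempty := fun e => Finset.card_pos.1 (by rw [hc]; norm_num)
  rw [summary_eq hη.le, List.length_map]
  refine le_trans (Nat.cast_le.2 (length_filter_keep_le hne _ _)) ?_
  rw [Nat.cast_sum, ← Finset.card_univ, ← nsmul_eq_mul]
  exact Finset.sum_le_card_nsmul _ _ _ fun v _ => natCast_le_of_pow_le hη hη1
    ((isSteep_run X).pow_countP_keep_le hη (isStack_run hη.le X) v)

/-- The number of buckets is logarithmic in the ratio of the extreme values of a bucket. -/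
lemma Invariant.length_le {L : ℕ} {s : List E} {ages : List ℕ}
    (h : Invariant ends w η L s ages) (hη : 0 < η) (hη1 : η < 1) (hc : ∀ e, (ends e).card = 2)
    {lo hi : ℝ} (hlo : 0 < lo) (hs : ∀ e ∈ s, lo ≤ w e ∧ w e ≤ hi) (hlh : lo ≤ hi)
    (hV : 1 ≤ Fintype.card V) :
    (ages.length : ℝ) ≤ 3 + 2 / η * Real.log (2 * Fintype.card V * (hi / lo)) := by
  have hne : ∀ e, (ends e).Nonempty := fun e => Finset.card_pos.1 (by rw [hc]; norm_num)
  obtain ⟨l, rfl⟩ : ∃ l, ages = l ++ [0] := List.getLast?_eq_some_iff.1 h.last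
  have hpos : ∀ a ∈ l, 0 < a := by
    have hpw := List.isChain_iff_pairwise.1 (h.chain.imp fun a b (hab : Link ends w η s a b) =>
      (hab.1 : a > b))
    rw [List.pairwise_append] at hpw
    exact fun a ha => hpw.2.2 a ha 0 (by simp)
  have hV' : (1 : ℝ) ≤ Fintype.card V := by exact_mod_cast hV
  have hmem : ∀ a, ∀ e ∈ slidingWindow a s, e ∈ s := fun a e he => (List.drop_suffix _ s).subset he
  have key := h.sparse.of_append_singleton.length_le (m := lo / 2) (B := Fintype.card V * hi)
    hη1 (by linarith) (fun a ha => ?_) (by nlinarith) hη.le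
  · have : Fintype.card V * hi / (lo / 2) = 2 * Fintype.card V * (hi / lo) := by
      field_simp
    rw [this] at key
    rw [List.length_append, List.length_singleton]
    push_cast
    have h2 : (l.length : ℝ) ≤ (2 * Real.log (2 * Fintype.card V * (hi / lo)) + 2 * η) / η :=
      (le_div_iff₀ hη).2 key
    rw [add_div, mul_div_assoc, mul_div_cancel_right₀ _ hη.ne'] at h2
    have h3 : 2 * (Real.log (2 * Fintype.card V * (hi / lo)) / η)
      = 2 / η * Real.log (2 * Fintype.card V * (hi / lo)) := by ring
    linarith
  · have hS : IsStack ends w (run ends w η (slidingWindow a s)) := isStack_run hη.le _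
    simp only [bucket]
    rw [summary_eq hη.le]
    constructor
    · have hlen := length_slidingWindow (h.le_length a (by simp [ha]))
      obtain ⟨e, he⟩ : ∃ e, e ∈ slidingWindow a s :=
        List.exists_mem_of_length_pos (by rw [hlen]; exact hpos a ha)
      have h1 := weight_le_of_mem (w := w) hη.le hne he
      have h2 := Finset.sum_le_sum_of_subset_of_nonneg (Finset.subset_univ (ends e))
        fun v _ _ => hS.potential_nonneg v
      have h3 := (hs e (hmem a e he)).1
      have h4 : 0 ≤ ∑ v, potential ends (run ends w η (slidingWindow a s)) v :=
        Finset.sum_nonneg fun v _ => hS.potential_nonneg v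
      simp only
      nlinarith
    · refine (Finset.sum_le_card_nsmul _ _ hi fun v _ => ?_).trans_eq
        (by rw [nsmul_eq_mul, Finset.card_univ])
      exact hS.potential_le (by linarith) fun p hp => (hs _ (hmem a _ (mem_of_mem_run hp))).2

end Size

end SmoothHistogram

/-! ### The memory of the sliding-window algorithm -/

namespace SlidingMatching

open LocalRatio SmoothHistogram BitCode Rounding

section Memory

variable {n : ℕ} {W : Finset ℝ}

lemma ends_weight_injective :
    Function.Injective fun e : WEdge n W => (e.ends, (⟨e.weight, e.weight_mem⟩ : W)) := by
  rintro ⟨a, ha, x, hx⟩ ⟨b, hb, y, hy⟩ h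
  simp only [Prod.mk.injEq, Subtype.mk.injEq] at h
  obtain ⟨rfl, rfl⟩ := h
  rfl

instance : Finite (WEdge n W) := Finite.of_injective _ ends_weight_injective

lemma card_wEdge_le : Nat.card (WEdge n W) ≤ n ^ 2 * W.card := by
  have h1 : Nat.card (WEdge n W) ≤ Nat.card (Sym2 (Fin n) × W) :=
    Nat.card_le_card_of_injective _ ends_weight_injective
  have h2 : Nat.card (Sym2 (Fin n)) ≤ Nat.card (Fin n × Fin n) :=
    Nat.card_le_card_of_surjective (fun p : Fin n × Fin n => s(p.1, p.2)) fun z => by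
      induction z with | _ a b => exact ⟨(a, b), rfl⟩
  rw [Nat.card_prod, Nat.card_eq_fintype_card (α := W), Fintype.card_coe] at h1
  rw [Nat.card_prod, Nat.card_fin, ← pow_two] at h2
  exact h1.trans (Nat.mul_le_mul_right _ h2)

/-- The two ends of an edge as a finite set. -/
def verts (e : WEdge n W) : Finset (Fin n) := e.ends.toFinset

lemma card_verts (e : WEdge n W) : (verts e).card = 2 :=
  Sym2.card_toFinset_of_not_isDiag _ e.notLoop

/-- The weight of an edge, rounded down. -/
noncomputable def rounded (η : ℝ) (e : WEdge n W) : ℝ := roundDown η e.weight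

/-- A description of a state consists of an edge, whose weight defines a unit (a list, as there may
be no edges at all), and for each bucket of its age, its potentials as multiples of the unit, and
its heavy edges. -/
abbrev Description (n : ℕ) (W : Finset ℝ) : Type :=
  List (WEdge n W) × List (ℕ × List ℕ × List (WEdge n W))

/-- The code words for descriptions. -/
noncomputable def encode : Description n W → List Bool := fun r =>
  listCode (finiteCode _) r.1 ++
    listCode (fun b => natCode b.1 ++ (listCode natCode b.2.1 ++ listCode (finiteCode _) b.2.2)) r.2

lemma encode_injective : Function.Injective (encode (n := n) (W := W)) :=
  SelfDelimiting.injective <| selfDelimiting_finiteCode.listCode.prod <| SelfDelimiting.listCode <|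
    selfDelimiting_natCode.prod <|
      selfDelimiting_natCode.listCode.prod selfDelimiting_finiteCode.listCode

/-- The state with a given description. -/
noncomputable def decode (η : ℝ) (r : Description n W) : State (Fin n) (WEdge n W) :=
  r.2.map fun b =>
    (b.1, fun v => (b.2.1.getD v 0 : ℕ) * unit η ((r.1.map WEdge.weight).headD 1), b.2.2)

/-- A bucket of a stream with weights between that of `e₀` and `hi` has a short description. -/
lemma exists_bucket_description {η : ℝ} (hη : 0 < η) {s : List (WEdge n W)}
    {e₀ : WEdge n W} {hi : ℝ} (h0 : 0 < e₀.weight)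
    (hs : ∀ e ∈ s, e₀.weight ≤ e.weight ∧ e.weight ≤ hi) (hhi : e₀.weight ≤ hi) (a : ℕ) :
    ∃ m : List ℕ, m.length = n ∧ (∀ k ∈ m, (k : ℝ) ≤ 2 / η * (hi / e₀.weight)) ∧
      (fun v : Fin n => (m.getD v 0 : ℕ) * unit η e₀.weight) =
        (bucket verts (rounded η) η s a).2.1 := by
  have hmem : ∀ e ∈ slidingWindow a s, e ∈ s := fun e he => (List.drop_suffix _ s).subset he
  have hS : IsStack verts (rounded η) (run verts (rounded η) η (slidingWindow a s)) :=
    isStack_run hη.le _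
  have hφ : (bucket verts (rounded η) η s a).2.1
      = potential verts (run verts (rounded η) η (slidingWindow a s)) := by
    rw [bucket, summary_eq hη.le]
  have hG := fun v => potential_run_mem (ends := verts) (w := rounded η) (η := η)
    (AddSubgroup.zmultiples (unit η e₀.weight)) (X := slidingWindow a s)
    (fun e he => roundDown_mem_zmultiples hη h0 (hs e (hmem e he)).1) v
  have hm : ∀ v, ∃ k : ℕ, (k : ℝ) * unit η e₀.weight
      = potential verts (run verts (rounded η) η (slidingWindow a s)) v := by
    intro v
    obtain ⟨z, hz⟩ := AddSubgroup.mem_zmultiples_iff.1 (hG v)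
    have hz0 : 0 ≤ z := by
      have := hS.potential_nonneg v
      rw [← hz, zsmul_eq_mul] at this
      exact_mod_cast nonneg_of_mul_nonneg_left this unit_pos
    lift z to ℕ using hz0
    exact ⟨z, by rw [← hz]; simp⟩
  choose m hm using hm
  refine ⟨List.ofFn m, by simp, fun k hk => ?_, ?_⟩
  · obtain ⟨v, rfl⟩ := (List.mem_ofFn' _ _).1 hk
    have hle : potential verts (run verts (rounded η) η (slidingWindow a s)) v ≤ hi :=
      hS.potential_le (by linarith) fun p hp => by
        have := hs _ (hmem _ (mem_of_mem_run hp))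
        exact (roundDown_le (by linarith)).trans this.2
    rw [← hm] at hle
    have h2 := lt_two_mul_unit (η := η) (x := e₀.weight)
    rw [div_mul_div_comm, le_div_iff₀ (mul_pos hη h0)]
    have h3 := mul_le_mul_of_nonneg_left h2.le (Nat.cast_nonneg (α := ℝ) (m v))
    linarith
  · rw [hφ]
    funext v
    rw [← hm v]
    simp

/-- The number of bits in terms of the number of vertices `n`, the parameter `η`, the window
length `L`, and the ratio `ρ` of the extreme weights. -/
lemma exists_description {K L : ℕ} {η : ℝ} (hn : 3 ≤ n) (hW : W.card ≤ n ^ K) (hL : 1 ≤ L)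
    (hη : 0 < η) (hη1 : η ≤ 1 / 10)
    {s : List (WEdge n W)} {e₀ : WEdge n W} {hi : ℝ} (h0 : 0 < e₀.weight)
    (hs : ∀ e ∈ s, e₀.weight ≤ e.weight ∧ e.weight ≤ hi) (hhi : e₀.weight ≤ hi) :
    ∃ r : Description n W, decode η r = histogram verts (rounded η) η L s ∧
      ((encode r).length : ℝ) ≤ (3 + 3 * ((K + 2) * Real.log n)) + 3 +
        (3 + 2 / η * Real.log (4 * n * (hi / e₀.weight))) *
          (6 + 3 * Real.log L + n * (4 + 3 * Real.log (2 / η * (hi / e₀.weight))) +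
            n * (4 / η * Real.log (2 / η)) * (4 + 3 * ((K + 2) * Real.log n))) := by
  obtain ⟨ages, hages, hinv⟩ := exists_invariant (w := rounded η) hη.le card_verts hL s
  choose m hmlen hmle hmeq using exists_bucket_description hη h0 hs hhi
  set S := fun a => (bucket verts (rounded η) η s a).2.2
  have hn' : (3 : ℝ) ≤ n := by exact_mod_cast hn
  have hρ : 1 ≤ hi / e₀.weight := (one_le_div h0).2 hhi
  have h2η : 1 ≤ 2 / η := by rw [le_div_iff₀ hη]; linarith
  have hlogn : 0 ≤ Real.log n := Real.log_nonneg (by linarith)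
  have hlogL : 0 ≤ Real.log L := Real.log_nonneg (by exact_mod_cast hL)
  have hlogη : 0 ≤ Real.log (2 / η * (hi / e₀.weight)) :=
    Real.log_nonneg (one_le_mul_of_one_le_of_one_le h2η hρ)
  have hK : (0 : ℝ) ≤ K := Nat.cast_nonneg K
  refine ⟨([e₀], ages.map fun a => (a, m a, S a)), ?_, ?_⟩
  · rw [hages, decode, List.map_map]
    refine List.map_congr_left fun a _ => ?_
    simp only [Function.comp, List.map_cons, List.headD_cons]
    rw [hmeq]
    rfl
  · have hcode : ∀ e : WEdge n W,
        ((finiteCode _ e).length : ℝ) ≤ 3 + 3 * ((K + 2) * Real.log n) := by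
      intro e
      have hcard : (Nat.card (WEdge n W) : ℝ) ≤ (n : ℝ) ^ (K + 2) := by
        have : Nat.card (WEdge n W) ≤ n ^ (K + 2) :=
          card_wEdge_le.trans ((Nat.mul_le_mul_left _ hW).trans_eq (by ring))
        exact_mod_cast this
      have := length_finiteCode_le (one_le_pow₀ (by linarith)) hcard e
      rw [Real.log_pow] at this
      push_cast at this
      exact this
    have hbase := length_listCode_le (l := [e₀]) fun e _ => hcode e
    have hbucket : ∀ b ∈ ages.map fun a => (a, m a, S a),
        ((natCode b.1 ++ (listCode natCode b.2.1 ++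
          listCode (finiteCode (WEdge n W)) b.2.2)).length : ℝ) ≤
        5 + 3 * Real.log L + n * (4 + 3 * Real.log (2 / η * (hi / e₀.weight))) +
            n * (4 / η * Real.log (2 / η)) * (4 + 3 * ((K + 2) * Real.log n)) := by
      intro b hb
      obtain ⟨a, ha, rfl⟩ := List.mem_map.1 hb
      have b1 := length_natCode_le (m := a) (x := L)
        (by exact_mod_cast hinv.le_window a ha) (by exact_mod_cast hL)
      have b2 := length_listCode_le (c := natCode) (l := m a) fun k hk =>
        length_natCode_le (hmle a k hk) (one_le_mul_of_one_le_of_one_le h2η hρ)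
      have b3 := length_listCode_le (l := S a) fun e _ => hcode e
      have b4 : ((S a).length : ℝ) ≤ n * (4 / η * Real.log (2 / η)) := by
        have := length_summary_le (ends := verts) (w := rounded η) hη (by linarith)
          card_verts (slidingWindow a s)
        rw [Fintype.card_fin] at this
        exact this
      have b5 := mul_le_mul_of_nonneg_right b4
        (by positivity : 0 ≤ 3 + 3 * ((K + 2) * Real.log n) + 1)
      rw [hmlen] at b2
      simp only [List.length_append]
      push_cast
      linarith
    have hall := length_listCode_le hbucket
    have hcount : (ages.length : ℝ) ≤ 3 + 2 / η * Real.log (4 * n * (hi / e₀.weight)) := by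
      have hw0 : 0 < rounded η e₀ := lt_of_lt_of_le (by nlinarith) (le_roundDown hη h0)
      have := hinv.length_le (lo := (1 - η) * e₀.weight) (hi := hi) hη (by linarith) card_verts
        (by nlinarith) (fun e he => ?_) (by nlinarith) (by simp; omega)
      · refine this.trans ?_
        rw [Fintype.card_fin]
        have h3 : 2 * (n : ℝ) * (hi / ((1 - η) * e₀.weight)) ≤ 4 * n * (hi / e₀.weight) := by
          have : hi / ((1 - η) * e₀.weight) ≤ 2 * (hi / e₀.weight) := by
            rw [← mul_div_assoc, div_le_div_iff₀ (by nlinarith) h0]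
            nlinarith [mul_nonneg (by linarith : 0 ≤ hi) h0.le]
          nlinarith
        have h4 : 0 < hi / ((1 - η) * e₀.weight) := div_pos (by linarith) (by nlinarith)
        gcongr
      · have h1 := hs e he
        have he0 : 0 < e.weight := h0.trans_le h1.1
        refine ⟨le_trans ?_ (le_roundDown hη he0), (roundDown_le he0.le).trans h1.2⟩
        exact mul_le_mul_of_nonneg_left h1.1 (by linarith)
    rw [List.length_map] at hall
    rw [encode, List.length_append]
    push_cast
    have hB : 0 ≤ 6 + 3 * Real.log L + n * (4 + 3 * Real.log (2 / η * (hi / e₀.weight))) +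
            n * (4 / η * Real.log (2 / η)) * (4 + 3 * ((K + 2) * Real.log n)) := by
      have := Real.log_nonneg h2η
      positivity
    have hmul := mul_le_mul_of_nonneg_right hcount hB
    simp only [List.length_cons, List.length_nil, zero_add, Nat.cast_one, one_mul] at hbase
    linarith

end Memory

/-! ### Bounds in terms of `σ` -/

section Bounds

/-- The arithmetic of the space bound. Here `S`, `l`, `Λ`, `N` stand for `log σ`, `log (1 / ε)`,
`log L` and `log n`, and `a`, `b`, `c` for the logarithms in `exists_description`. -/
lemma bit_bound {K n S l Λ N ε a b c : ℝ} (hK : 0 ≤ K) (hn : 3 ≤ n) (hε : 0 < ε)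
    (hε1 : ε ≤ 1 / 10) (hS : 2 / 5 ≤ S) (hl : 1 ≤ l) (hΛ : 0 ≤ Λ) (hNS : N ≤ 3 * S)
    (ha : a ≤ 7 * S) (hb0 : 0 ≤ b) (hb : b ≤ 5 * l + S) (hc0 : 0 ≤ c) (hc : c ≤ 5 * l)
    (hN : 0 ≤ N) :
    (3 + 3 * ((K + 2) * N)) + 3 + (3 + 2 / (ε / 20) * a) *
      (6 + 3 * Λ + n * (4 + 3 * b) + n * (4 / (ε / 20) * c) * (4 + 3 * ((K + 2) * N))) ≤
    2000000 * (K + 3) * (l / ε ^ 2 * n * S ^ 2 + 1 / ε * S * Λ) := by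
  obtain ⟨t, rfl⟩ : ∃ t, ε = 1 / t := ⟨1 / ε, by simp⟩
  have ht0 : 0 < t := by simpa using hε
  have ht : 10 ≤ t := by
    rwa [div_le_div_iff_of_pos_left one_pos ht0 (by norm_num)] at hε1
  rw [show 2 / (1 / t / 20) = 40 * t by field_simp; norm_num,
    show 4 / (1 / t / 20) = 80 * t by field_simp; norm_num,
    show l / (1 / t) ^ 2 * n * S ^ 2 + 1 / (1 / t) * S * Λ = n * l * S * t * (S * t) + t * S * Λ by
      field_simp]
  have hlS : 2 / 5 ≤ l * S := by nlinarith
  have htS : 4 ≤ t * S := by nlinarith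
  have hnlS : 6 / 5 ≤ n * (l * S) := by nlinarith
  have hU : 12 ≤ n * l * S * t := by nlinarith
  have hNK : (K + 2) * N ≤ (K + 2) * (3 * S) := mul_le_mul_of_nonneg_left hNS (by linarith)
  have hKS : 0 ≤ K * S := mul_nonneg hK (by linarith)
  have h1 : 3 + 40 * t * a ≤ 300 * (t * S) := by
    have := mul_le_mul_of_nonneg_left ha (by linarith : 0 ≤ 40 * t)
    linarith
  have h2 : n * (4 + 3 * b) ≤ 6 * (n * l * S * t) := by
    have h : 4 + 3 * b ≤ 60 * (l * S) := by nlinarith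
    have h' := mul_le_mul_of_nonneg_left h (by linarith : 0 ≤ n)
    have h'' := mul_le_mul_of_nonneg_left ht (by linarith : 0 ≤ n * (l * S))
    linarith
  have h3 : 4 + 3 * ((K + 2) * N) ≤ 10 * ((K + 3) * S) := by linarith
  have h4 : n * (80 * t * c) * (4 + 3 * ((K + 2) * N)) ≤ 4000 * ((K + 3) * (n * l * S * t)) := by
    have h5 : n * (80 * t * c) ≤ 400 * (n * t * l) := by
      have := mul_le_mul_of_nonneg_left hc (by positivity : 0 ≤ n * (80 * t))
      linarith
    have h6 := mul_le_mul h5 h3 (by positivity) (by positivity)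
    linarith
  have hKU : 36 ≤ (K + 3) * (n * l * S * t) := by nlinarith
  have h7 : 6 + 3 * Λ + n * (4 + 3 * b) + n * (80 * t * c) * (4 + 3 * ((K + 2) * N)) ≤
      3 * Λ + 5000 * ((K + 3) * (n * l * S * t)) := by nlinarith
  have h8 := mul_le_mul h1 h7 (by positivity) (by positivity)
  have h9 : 3 + 3 * ((K + 2) * N) + 3 ≤ 100 * ((K + 3) * (n * l * S * t) * (t * S)) := by
    have h10 : 3 + 3 * ((K + 2) * N) + 3 ≤ 20 * ((K + 3) * S) := by linarith
    have h11 : (K + 3) * S ≤ (K + 3) * (n * l * S * t) * (t * S) := by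
      have h12 : 1 ≤ n * l * S * t * t := by nlinarith
      have := mul_le_mul_of_nonneg_left h12 (by positivity : 0 ≤ (K + 3) * S)
      linarith
    have : 0 ≤ (K + 3) * S := by positivity
    linarith
  have h13 : 0 ≤ K * (t * S * Λ) := by positivity
  have h14 : 0 ≤ t * S * Λ := by positivity
  have h15 : 0 ≤ (K + 3) * (n * l * S * t) * (t * S) := by positivity
  linarith

lemma two_fifths_le_log : 2 / 5 ≤ Real.log (3 / 2) := by
  have h : (2 : ℝ) ≤ Real.log ((3 / 2) ^ 5) := by
    rw [Real.le_log_iff_exp_le (by norm_num), show (2 : ℝ) = 1 + 1 by norm_num, Real.exp_add]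
    have := Real.exp_one_lt_d9
    have := Real.exp_pos 1
    nlinarith
  rw [Real.log_pow] at h
  push_cast at h
  linarith

lemma log_forty_le : Real.log 40 ≤ 4 := by
  rw [Real.log_le_iff_le_exp (by norm_num), show (4 : ℝ) = 1 + 1 + 1 + 1 by norm_num,
    Real.exp_add, Real.exp_add, Real.exp_add]
  have h := Real.exp_one_gt_d9
  calc (40 : ℝ) ≤ 2.7 * 2.7 * 2.7 * 2.7 := by norm_num
    _ ≤ _ := by gcongr <;> linarith

lemma one_le_log_one_div {ε : ℝ} (hε : 0 < ε) (hε1 : ε ≤ 1 / 10) : 1 ≤ Real.log (1 / ε) := by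
  rw [Real.le_log_iff_exp_le (by positivity), le_div_iff₀ hε]
  have := Real.exp_one_lt_d9
  nlinarith

/-- The number of bits used by the description of a state, in terms of `σ = n / 2 * ρ`. -/
lemma description_bound {K n L : ℕ} {ε ρ : ℝ} (hn : 3 ≤ n) (hL : 1 ≤ L) (hε : 0 < ε)
    (hε1 : ε ≤ 1 / 10) (hρ : 1 ≤ ρ) :
    (3 + 3 * ((K + 2) * Real.log n)) + 3 + (3 + 2 / (ε / 20) * Real.log (4 * n * ρ)) *
      (6 + 3 * Real.log L + n * (4 + 3 * Real.log (2 / (ε / 20) * ρ)) +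
        n * (4 / (ε / 20) * Real.log (2 / (ε / 20))) * (4 + 3 * ((K + 2) * Real.log n))) ≤
    2000000 * (K + 3) * (Real.log (1 / ε) / ε ^ 2 * n * Real.log ((n : ℝ) / 2 * ρ) ^ 2 +
      1 / ε * Real.log ((n : ℝ) / 2 * ρ) * Real.log L) := by
  have hn' : (3 : ℝ) ≤ n := by exact_mod_cast hn
  have hσ : 3 / 2 ≤ (n : ℝ) / 2 * ρ := by nlinarith
  have hS : 2 / 5 ≤ Real.log ((n : ℝ) / 2 * ρ) :=
    two_fifths_le_log.trans (Real.log_le_log (by norm_num) hσ)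
  have hl := one_le_log_one_div hε hε1
  have hlog2 := Real.log_two_lt_d9
  have hlog2' := Real.log_two_gt_d9
  have h40 : Real.log (2 / (ε / 20)) = Real.log 40 + Real.log (1 / ε) := by
    rw [← Real.log_mul (by norm_num) (by positivity)]
    congr 1
    field_simp
    norm_num
  have h40' : 1 ≤ 2 / (ε / 20) := by
    rw [le_div_iff₀ (by positivity)]
    linarith
  refine bit_bound (Nat.cast_nonneg K) hn' hε hε1 hS hl
    (Real.log_nonneg (by exact_mod_cast hL)) ?_ ?_ ?_ ?_ (Real.log_nonneg h40') ?_
    (Real.log_nonneg (by linarith))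
  · have : Real.log n ≤ Real.log (2 * ((n : ℝ) / 2 * ρ)) :=
      Real.log_le_log (by linarith) (by nlinarith)
    rw [Real.log_mul (by norm_num) (by positivity)] at this
    linarith
  · rw [show 4 * (n : ℝ) * ρ = 2 ^ 3 * (n / 2 * ρ) by ring,
      Real.log_mul (by norm_num) (by positivity), Real.log_pow]
    push_cast
    linarith
  · exact Real.log_nonneg (one_le_mul_of_one_le_of_one_le h40' hρ)
  · rw [Real.log_mul (by positivity) (by positivity), h40]
    have : Real.log ρ ≤ Real.log ((n : ℝ) / 2 * ρ) := Real.log_le_log (by positivity) (by nlinarith)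
    linarith [log_forty_le]
  · rw [h40]
    linarith [log_forty_le]

end Bounds

/-! ### The extreme weights of a stream -/

section Extremes

variable {n : ℕ} {W : Finset ℝ}

lemma finite_weights (s : List (WEdge n W)) : (WEdge.weight '' {e | e ∈ s}).Finite :=
  (List.finite_toSet s).image _

lemma exists_weight_eq_wMin {s : List (WEdge n W)} (hs : s ≠ []) :
    ∃ e ∈ s, e.weight = wMin s := by
  obtain ⟨e, he⟩ := List.exists_mem_of_ne_nil s hs
  exact Set.Nonempty.csInf_mem (s := WEdge.weight '' {e | e ∈ s}) ⟨_, e, he, rfl⟩ (finite_weights s)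

lemma wMin_le_weight {s : List (WEdge n W)} {e : WEdge n W} (he : e ∈ s) : wMin s ≤ e.weight :=
  csInf_le (finite_weights s).bddBelow ⟨e, he, rfl⟩

lemma weight_le_wMax {s : List (WEdge n W)} {e : WEdge n W} (he : e ∈ s) : e.weight ≤ wMax s :=
  le_csSup (finite_weights s).bddAbove ⟨e, he, rfl⟩

lemma isMatchingIn_iff {E : List (WEdge n W)} {M : Finset (WEdge n W)} :
    IsMatchingIn E M ↔ (∀ e ∈ M, e ∈ E) ∧ (M : Set (WEdge n W)).PairwiseDisjoint verts := by
  refine and_congr_right fun _ => forall₂_congr fun e _ => forall₂_congr fun f _ =>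
    forall_congr' fun _ => ?_
  simp [Function.onFun, Finset.disjoint_left, verts]

end Extremes

/-! ### The algorithm -/

section Algorithm

variable {n : ℕ} {W : Finset ℝ}

/-- The report of the histogram on the rounded weights, with `η = ε / 20`. -/
lemma isApproxMWM_report {L : ℕ} {ε : ℝ} (hL : 1 ≤ L) (hε : 0 < ε) (hε1 : ε ≤ 1 / 10)
    (hW : ∀ w ∈ W, 0 < w) (s : List (WEdge n W)) :
    IsApproxMWM (3 + ε) (slidingWindow L s)
      (histogramReport verts (histogram verts (rounded (ε / 20)) (ε / 20) L s)) := by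
  obtain ⟨h1, h2, h3⟩ := histogramReport_spec (w := rounded (ε / 20)) (η := ε / 20)
    (by linarith) (by linarith) card_verts hL s
  refine ⟨isMatchingIn_iff.2 ⟨h1, h2⟩, fun M hM => ?_⟩
  obtain ⟨hM1, hM2⟩ := isMatchingIn_iff.1 hM
  have h := h3 M hM2 hM1
  set M₀ := histogramReport verts (histogram verts (rounded (ε / 20)) (ε / 20) L s)
  have hpos : ∀ e : WEdge n W, 0 < e.weight := fun e => hW _ e.weight_mem
  have hle : ∑ e ∈ M₀, rounded (ε / 20) e ≤ totalWeight M₀ :=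
    Finset.sum_le_sum fun e _ => roundDown_le (hpos e).le
  have hge : (1 - ε / 20) * totalWeight M ≤ ∑ e ∈ M, rounded (ε / 20) e := by
    rw [totalWeight, Finset.mul_sum]
    exact Finset.sum_le_sum fun e _ => le_roundDown (by linarith) (hpos e)
  have hM0 : 0 ≤ totalWeight M₀ := Finset.sum_nonneg fun e _ => (hpos e).le
  have hM' : 0 ≤ totalWeight M := Finset.sum_nonneg fun e _ => (hpos e).le
  have h4 := mul_le_mul_of_nonneg_left hge
    (mul_nonneg (by linarith) (by linarith) : 0 ≤ (1 - 2 * (ε / 20)) * (1 - ε / 20))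
  have h5 := mul_le_mul_of_nonneg_left hle (by linarith : 0 ≤ 3 * (1 + ε / 20))
  have h6 : 1 - 4 * (ε / 20) ≤ (1 - 2 * (ε / 20)) * (1 - ε / 20) * (1 - ε / 20) := by
    nlinarith [mul_nonneg (sq_nonneg (ε / 20)) (by linarith : 0 ≤ 5 - 2 * (ε / 20))]
  have h7 : 3 * (1 + ε / 20) ≤ (1 - 4 * (ε / 20)) * (3 + ε) := by nlinarith
  have h8 := mul_le_mul_of_nonneg_right h6 hM'
  have h9 := mul_le_mul_of_nonneg_right h7 hM0
  refine le_of_mul_le_mul_left ?_ (by linarith : 0 < 1 - 4 * (ε / 20))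
  linarith

/-- The sliding-window algorithm together with its first space bound. -/
theorem exists_algorithm {K L : ℕ} {ε : ℝ} (hn : 3 ≤ n) (hL : 1 ≤ L) (hε : 0 < ε)
    (hε1 : ε ≤ 1 / 10) (hW : ∀ w ∈ W, 0 < w) (hcard : W.card ≤ n ^ K) :
    ∃ A : StreamingAlgorithm (WEdge n W) (Finset (WEdge n W)), ∀ s : List (WEdge n W), s ≠ [] →
      IsApproxMWM (3 + ε) (slidingWindow L s) (A.reportAfter s) ∧
      (A.space s : ℝ) ≤ 2000000 * (K + 3) *
        (Real.log (1 / ε) / ε ^ 2 * n * Real.log (sigma s) ^ 2 +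
          1 / ε * Real.log (sigma s) * Real.log L) := by
  -- A description of a prefix may use the smallest weight of the whole stream as its unit.
  have hdescr : ∀ s : List (WEdge n W), s ≠ [] → ∀ p : List (WEdge n W), (∀ e ∈ p, e ∈ s) →
      ∃ r : Description n W,
        decode (ε / 20) r = histogram verts (rounded (ε / 20)) (ε / 20) L p ∧
        ((encode r).length : ℝ) ≤ 2000000 * (K + 3) *
          (Real.log (1 / ε) / ε ^ 2 * n * Real.log (sigma s) ^ 2 +
            1 / ε * Real.log (sigma s) * Real.log L) := by
    intro s hs p hp
    obtain ⟨e₀, he₀, hmin⟩ := exists_weight_eq_wMin hs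
    have h0 : 0 < e₀.weight := hW _ e₀.weight_mem
    have hhi := weight_le_wMax he₀
    obtain ⟨r, h1, h2⟩ := exists_description (η := ε / 20) (s := p) hn hcard hL (by linarith)
      (by linarith) h0 (fun e he => ⟨hmin ▸ wMin_le_weight (hp e he), weight_le_wMax (hp e he)⟩) hhi
    refine ⟨r, h1, h2.trans ((description_bound hn hL hε hε1 ((one_le_div h0).2 hhi)).trans_eq ?_)⟩
    rw [sigma, ← hmin]
  obtain ⟨A, hA⟩ := exists_streamingAlgorithm (I := WEdge n W) [(0, 0, [])]
    (histogramStep verts (rounded (ε / 20)) (ε / 20) L) (histogramReport verts)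
    encode_injective (decode (ε / 20)) (fun s => by
      rcases eq_or_ne s [] with rfl | hs
      · exact ⟨([], [(0, [], [])]), by simp [decode]; rfl⟩
      · obtain ⟨r, hr, -⟩ := hdescr s hs s fun _ => id
        exact ⟨r, hr⟩)
  refine ⟨A, fun s hs => ⟨?_, ?_⟩⟩
  · rw [(hA s).1]
    exact isApproxMWM_report hL hε hε1 hW s
  · obtain ⟨i, -, hi⟩ := Finset.exists_mem_eq_sup (Finset.range (s.length + 1))
      (by simp) fun i => (A.memory (s.take i)).length
    obtain ⟨r, hr, hlen⟩ := hdescr s hs (s.take i) fun e he => List.mem_of_mem_take he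
    rw [StreamingAlgorithm.space, hi]
    exact le_trans (by exact_mod_cast (hA (s.take i)).2 r hr) hlen

end Algorithm

end SlidingMatching

theorem theorem1 :
    ∀ K : ℕ, ∃ C : ℝ, 0 < C ∧
      ∀ (n L : ℕ) (ε : ℝ) (W : Finset ℝ),
        3 ≤ n → 1 ≤ L → 0 < ε → ε ≤ 1 / 10 →
        (∀ w ∈ W, 0 < w) → W.card ≤ n ^ K →
        ∃ A : StreamingAlgorithm (WEdge n W) (Finset (WEdge n W)),
          ∀ s : List (WEdge n W), s ≠ [] →
            IsApproxMWM (3 + ε) (slidingWindow L s) (A.reportAfter s) ∧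
            (A.space s : ℝ) ≤
              C * (Real.log (1 / ε) / ε ^ 2 * n * Real.log (sigma s) ^ 2
                + 1 / ε * Real.log (sigma s) * Real.log L) ∧
            (L ≤ n ^ (K * n) →
              (A.space s : ℝ) ≤
                C * (Real.log (1 / ε) / ε ^ 2 * n * Real.log (sigma s) ^ 2)) ∧
            (L ≤ n ^ (K * n) → wMax s / wMin s ≤ (n : ℝ) ^ K →
              (A.space s : ℝ) ≤
                C * (Real.log (1 / ε) / ε ^ 2 * n * Real.log n ^ 2)) := by
  intro K
  have hK : (0 : ℝ) ≤ K := Nat.cast_nonneg K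
  refine ⟨2000000 * (K + 3) * (1 + 3 * K) * (K + 1) ^ 2, by positivity, ?_⟩
  intro n L ε W hn hL hε hε1 hW hcard
  obtain ⟨A, hA⟩ := SlidingMatching.exists_algorithm hn hL hε hε1 hW hcard
  refine ⟨A, fun s hs => ?_⟩
  obtain ⟨h1, h2⟩ := hA s hs
  have hn' : (3 : ℝ) ≤ n := by exact_mod_cast hn
  obtain ⟨e₀, he₀, hmin⟩ := SlidingMatching.exists_weight_eq_wMin hs
  have hρ : 1 ≤ wMax s / wMin s := by
    rw [← hmin]
    exact (one_le_div (hW _ e₀.weight_mem)).2 (SlidingMatching.weight_le_wMax he₀)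
  have hσ : 3 / 2 ≤ sigma s := by
    rw [sigma]
    nlinarith
  have hS : 2 / 5 ≤ Real.log (sigma s) :=
    SlidingMatching.two_fifths_le_log.trans (Real.log_le_log (by norm_num) hσ)
  have hl := SlidingMatching.one_le_log_one_div hε hε1
  have hlogL : 0 ≤ Real.log L := Real.log_nonneg (by exact_mod_cast hL)
  have hlogn : Real.log n ≤ 3 * Real.log (sigma s) := by
    have : Real.log n ≤ Real.log (2 * sigma s) :=
      Real.log_le_log (by linarith) (by rw [sigma]; nlinarith)
    rw [Real.log_mul (by norm_num) (by linarith)] at this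
    linarith [Real.log_two_lt_d9]
  set D : ℝ := 2000000 * (K + 3) with hD
  have hD0 : 0 ≤ D := by positivity
  set S := Real.log (sigma s)
  set T := Real.log (1 / ε) / ε ^ 2 * n * S ^ 2 with hT
  have hT0 : 0 ≤ T := by positivity
  have h3 : L ≤ n ^ (K * n) → (A.space s : ℝ) ≤ D * (1 + 3 * K) * T := by
    intro hLn
    have hΛ : Real.log L ≤ K * n * (3 * S) := by
      have h : Real.log L ≤ Real.log ((n : ℝ) ^ (K * n)) :=
        Real.log_le_log (by exact_mod_cast hL) (by exact_mod_cast hLn)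
      rw [Real.log_pow] at h
      push_cast at h
      exact h.trans (mul_le_mul_of_nonneg_left hlogn (by positivity))
    have h4 : 1 / ε * S * Real.log L ≤ 3 * K * T := by
      have h5 : 1 / ε ≤ Real.log (1 / ε) / ε ^ 2 := by
        rw [div_le_div_iff₀ hε (by positivity)]
        nlinarith
      calc 1 / ε * S * Real.log L ≤ Real.log (1 / ε) / ε ^ 2 * S * (K * n * (3 * S)) := by
            gcongr
        _ = 3 * K * T := by rw [hT]; ring
    have := mul_le_mul_of_nonneg_left h4 hD0
    linarith
  have hone : (1 : ℝ) ≤ (K + 1) ^ 2 := one_le_pow₀ (by linarith)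
  refine ⟨h1, h2.trans ?_, fun hLn => (h3 hLn).trans ?_, fun hLn hw => (h3 hLn).trans ?_⟩
  · have hG : 0 ≤ T + 1 / ε * S * Real.log L := by positivity
    refine mul_le_mul_of_nonneg_right ?_ hG
    rw [mul_assoc]
    exact le_mul_of_one_le_right hD0 (one_le_mul_of_one_le_of_one_le (by linarith) hone)
  · exact mul_le_mul_of_nonneg_right (le_mul_of_one_le_right (by positivity) hone) hT0
  · have hSn : S ≤ (K + 1) * Real.log n := by
      have h : S ≤ Real.log ((n : ℝ) ^ (K + 1)) := by
        refine Real.log_le_log (by linarith) ?_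
        rw [sigma, pow_succ, mul_comm ((n : ℝ) ^ K)]
        gcongr
        linarith
      rw [Real.log_pow] at h
      exact_mod_cast h
    have hS2 : S ^ 2 ≤ ((K + 1) * Real.log n) ^ 2 := by gcongr
    calc D * (1 + 3 * K) * T
        ≤ D * (1 + 3 * K) * (Real.log (1 / ε) / ε ^ 2 * n * ((K + 1) * Real.log n) ^ 2) := by
          rw [hT]
          gcongr
      _ = _ := by ring
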